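/- Theorem 2.5. Let $\|\cdot\|$ be an arbitrary norm on $\mathbb{C}^n$, $B=\{z\in\mathbb{C}^n : \|z\|<1\}$, and let $I$ be the identity matrix. A *decreasing subordination chain* is a family $(f_t)_{t\ge 0}$ of holomorphic maps $f_t:B\to\mathbb{C}^n$ such that for all $0\le s\le t$ there is a holomorphic $f_{s,t}:B\to B$ with $f_{s,t}(0)=0$ and $f_t=f_s\circ f_{s,t}$. A *normalized decreasing Loewner chain* is a family $(f_t)_{t\ge0}$ of biholomorphic maps $f_t:B\to f_t(B)$ onto open subsets of $\mathbb{C}^n$ such that $f_t(B)\subset f_s(B)$ for $0\le s\le t$, $f_0(z)=z$ for all $z\in B$, and $f_t(0)=0$, $Df_t(0)=e^{-t}I$ for all $t\ge0$. A *Herglotz function* is a holomorphic $h:B\to\mathbb{C}^n$ with $h(0)=0$, $Dh(0)=-I$ and $\operatorname{Re}\, l(h(z))<0$ for all $z\in B\setminus\{0\}$ and all linear functionals $l:\mathbb{C}^n\to\mathbb{C}$ with $l(z)=\|z\|$ and $\|l\|=1$. A *Herglotz vector field* is a map $M:B\times[0,\infty)\to\mathbb{C}^n$ such that $M(\cdot,t)$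 is a Herglotz function for all $t\ge0$ and $t\mapsto M(z,t)$ is (Lebesgue) measurable for all $z\in B$. For a family $(f_t)_{t\ge0}$ of holomorphic maps $f_t:B\to\mathbb{C}^n$ and a Herglotz vector field $M$, consider $$\frac{\partial}{\partial t}f_t(z)=Df_t(z)\cdot M(z,t)\quad\text{for a.e. } t\ge0 \text{ and all } z\in B,\qquad f_0(z)=z\ \text{ for all } z\in B, \tag{1}$$ where the exceptional null set of times does not depend on $z$. The family is called *absolutely continuous* if for every $z\in B$ the map $t\mapsto f_t(z)$ is absolutely continuous on $[0,T]$ for every $T>0$. (a) Let $(f_t)_{t\ge 0}$ be a decreasing subordination chain with $f_0(z)=z$ for all $z\in B$, and $f_t(0)=0$, $Df_t(0)=e^{-t}I$ for all $t\ge0$. Then $(f_t)$ is a normalized decreasing Loewner chain, and there is a Herglotz vector field $M$ such that $(f_t)$ satisfies (1). (b) Conversely, if $M$ is a Herglotz vector field, then there exists exactly one absolutely continuous family $(f_t)_{t\ge0}$ of holomorphic maps satisfying (1), and it is a normalized decreasing Loewner chain. -/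

import Mathlib

open Set Metric MeasureTheory

/-- The open unit ball `B = {z | ‖z‖ < 1}`. Here and below `E` plays the role of `ℂⁿ` with an
arbitrary norm. -/
def unitBall (E : Type*) [NormedAddCommGroup E] : Set E := ball (0 : E) 1

section

variable {E : Type*} [NormedAddCommGroup E] [NormedSpace ℂ E]

/-- A decreasing subordination chain `(f t)`, `t ≥ 0`: every `f t` is holomorphic on the unit ball
and, for `s ≤ t`, `f t = f s ∘ φ` on the unit ball for some Schwarz map `φ`, that is, a holomorphic
self-map of the unit ball that fixes the origin. Only the values for `t ≥ 0` and `z` in the unit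
ball matter. -/
def IsSubordinationChain (f : ℝ → E → E) : Prop :=
  (∀ t, 0 ≤ t → DifferentiableOn ℂ (f t) (unitBall E)) ∧
    ∀ s t, 0 ≤ s → s ≤ t → ∃ φ : E → E,
      DifferentiableOn ℂ φ (unitBall E) ∧ MapsTo φ (unitBall E) (unitBall E) ∧ φ 0 = 0 ∧
        ∀ z ∈ unitBall E, f t z = f s (φ z)

/-- `f` maps the unit ball biholomorphically onto its image: `f` is holomorphic, the image is open,
and `f` has a holomorphic inverse there. -/
def IsBiholomorphicOnBall (f : E → E) : Prop :=
  DifferentiableOn ℂ f (unitBall E) ∧ IsOpen (f '' unitBall E) ∧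
    ∃ g : E → E, DifferentiableOn ℂ g (f '' unitBall E) ∧ ∀ z ∈ unitBall E, g (f z) = z

/-- The normalization `f 0 = id`, `f t 0 = 0`, `D(f t)(0) = e⁻ᵗ I` for all `t ≥ 0`. -/
def IsNormalizedFamily (f : ℝ → E → E) : Prop :=
  (∀ z ∈ unitBall E, f 0 z = z) ∧
    ∀ t, 0 ≤ t → f t 0 = 0 ∧
      fderiv ℂ (f t) 0 = (Real.exp (-t) : ℂ) • ContinuousLinearMap.id ℂ E

/-- A normalized decreasing Loewner chain on the unit ball. -/
def IsLoewnerChain (f : ℝ → E → E) : Prop :=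
  (∀ t, 0 ≤ t → IsBiholomorphicOnBall (f t)) ∧
    (∀ s t, 0 ≤ s → s ≤ t → f t '' unitBall E ⊆ f s '' unitBall E) ∧
    IsNormalizedFamily f

/-- The class of Herglotz functions on the unit ball. -/
def IsHerglotzFunction (h : E → E) : Prop :=
  DifferentiableOn ℂ h (unitBall E) ∧ h 0 = 0 ∧
    fderiv ℂ h 0 = -ContinuousLinearMap.id ℂ E ∧
    ∀ z ∈ unitBall E, z ≠ 0 → ∀ l : E →L[ℂ] ℂ, l z = (‖z‖ : ℂ) → ‖l‖ = 1 → (l (h z)).re < 0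

/-- A Herglotz vector field: `M · t` is a Herglotz function for every `t ≥ 0`, and `t ↦ M z t` is
Lebesgue measurable on `[0, ∞)` for every `z` in the unit ball (for finite-dimensional `E`,
`AEStronglyMeasurable` with respect to Lebesgue measure is Lebesgue measurability). -/
def IsHerglotzVectorField (M : E → ℝ → E) : Prop :=
  (∀ t, 0 ≤ t → IsHerglotzFunction fun z => M z t) ∧
    ∀ z ∈ unitBall E, AEStronglyMeasurable (fun t => M z t) (volume.restrict (Ici (0 : ℝ)))

/-- `(f t)`, `t ≥ 0`, is a family of holomorphic maps on the unit ball with `f 0 = id` such that,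
for almost every `t ≥ 0`, `∂ f t z / ∂t` exists and equals `D(f t)(z) (M z t)` for all `z` in the
unit ball. -/
def SolvesLoewnerPDE (f : ℝ → E → E) (M : E → ℝ → E) : Prop :=
  (∀ t, 0 ≤ t → DifferentiableOn ℂ (f t) (unitBall E)) ∧
    (∀ z ∈ unitBall E, f 0 z = z) ∧
    ∀ᵐ t ∂(volume.restrict (Ici (0 : ℝ))), ∀ z ∈ unitBall E,
      HasDerivAt (fun s : ℝ => f s z) (fderiv ℂ (f t) z (M z t)) t

/-- For every `z` in the unit ball, `t ↦ f t z` is absolutely continuous on each compact interval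
`[0, T]`. -/
def IsAbsolutelyContinuousFamily (f : ℝ → E → E) : Prop :=
  ∀ z ∈ unitBall E, ∀ T : ℝ, 0 ≤ T → AbsolutelyContinuousOnInterval (fun t => f t z) 0 T

end

/-!
Everything rests on one growth estimate for dissipative maps, `norm_le_of_re_nonpos`: if `h` is
holomorphic on the unit ball with `h 0 = 0`, `Dh(0) = -c I` and `Re l(h z) ≤ 0` for all functionals
`l` norming `z`, then `‖h z‖ ≤ C(r) c` for `‖z‖ ≤ r < 1`. On complex lines through the origin the
Borel-Carathéodory theorem bounds the numerical range `l(h z)`; the passage from the numerical range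
to the norm, for an arbitrary norm, is `norm_le_of_numericalRange`. Herglotz functions are the case
`c = 1`, and `φ - id`, for a Schwarz map `φ` with `Dφ(0) = (1 - c) I`, is
the other case of interest.

For a normalized subordination chain, the transition maps `φ s t` are Schwarz maps with derivative
`e^(s-t) I` at the origin, so that `φ s t - id = O(t - s)` locally uniformly. Hence `φ s t` is
injective on a given smaller ball when `t - s` is small, and `f t`, a composition of such maps, is
biholomorphic (`IsSubordinationChain.isLoewnerChain`). The same estimate makes `f t z` Lipschitz in
`t`, so for almost every `t` it is differentiable in time, for all `z` at once; then
`(φ t (t + h) z - z) / h` converges as `h → 0+`, the limit is a Herglotz function of `z`, and the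
chain rule for `f (t + h) = f t ∘ φ t (t + h)` is the Loewner equation
(`IsSubordinationChain.exists_isHerglotzVectorField`).

Conversely, a Herglotz vector field `M` is a Carathéodory right-hand side that is locally Lipschitz,
uniformly in time. Its integral curves, run backwards, do not increase the norm, so that Picard
iteration over short time steps gives a flow of Schwarz maps (`isEvolutionFamily_flow`). Therefore
`f t = flow M 0 t` is a normalized subordination chain, to which the first part applies; Lebesgue's
differentiation theorem identifies its generator with `M` (`solvesLoewnerPDE_flow`).

For uniqueness, the difference of two solutions solves a linear equation with zero initial value.
Absolute continuity is only assumed pointwise in `z`, but by Baire's theorem the difference is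
bounded on some small ball, uniformly in time. A Cauchy-Kovalevskaya iteration shows that it
vanishes on the concentric ball of half the radius for a short time, the identity theorem extends
this to the unit ball, and the argument is repeated in time steps of fixed length
(`eq_zero_of_solves_linear`).
-/

open Filter Topology

/-! ### Cauchy estimates for maps between normed spaces -/

section CauchyEstimates

variable {E F : Type*} [NormedAddCommGroup E] [NormedSpace ℂ E]
  [NormedAddCommGroup F] [NormedSpace ℂ F] {f : E → F} {c : E} {R C : ℝ}

theorem norm_fderiv_le_of_forall_ball_norm_le (hR : 0 < R) (hf : DifferentiableOn ℂ f (ball c R))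
    (hC : ∀ z ∈ ball c R, ‖f z‖ ≤ C) : ‖fderiv ℂ f c‖ ≤ 2 * C / R := by
  refine Complex.norm_fderiv_le_div_of_mapsTo_ball hf (fun z hz => ?_) hR
  rw [mem_closedBall, dist_eq_norm]
  linarith [norm_sub_le (f z) (f c), hC z hz, hC c (mem_ball_self hR)]

theorem norm_sub_le_of_forall_ball_norm_le {r : ℝ} (hr : r < R)
    (hf : DifferentiableOn ℂ f (ball c R)) (hC : ∀ z ∈ ball c R, ‖f z‖ ≤ C) {x y : E}
    (hx : x ∈ closedBall c r) (hy : y ∈ closedBall c r) :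
    ‖f y - f x‖ ≤ 2 * C / (R - r) * ‖y - x‖ := by
  have hsub : ∀ z ∈ closedBall c r, ball z (R - r) ⊆ ball c R := fun z hz =>
    ball_subset_ball' (by rw [mem_closedBall] at hz; linarith)
  refine (convex_closedBall c r).norm_image_sub_le_of_norm_fderiv_le (𝕜 := ℂ)
    (fun z hz => ?_) (fun z hz => ?_) hx hy
  · exact hf.differentiableAt (isOpen_ball.mem_nhds (closedBall_subset_ball hr hz))
  · exact norm_fderiv_le_of_forall_ball_norm_le (by linarith) (hf.mono (hsub z hz))
      fun w hw => hC w (hsub z hz hw)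

/-- The quadratic Taylor estimate. It is uniform over all holomorphic maps with the same bound, and
this is what makes limits and integrals of holomorphic maps holomorphic below. -/
theorem norm_sub_sub_fderiv_le_of_forall_ball_norm_le (hf : DifferentiableOn ℂ f (ball c R))
    (hC : ∀ z ∈ ball c R, ‖f z‖ ≤ C) {z : E} (hz : z ∈ ball c R) :
    ‖f z - f c - fderiv ℂ f c (z - c)‖ ≤ 4 * C * (‖z - c‖ / R) ^ 2 := by
  have hR : 0 < R := nonempty_ball.1 ⟨z, hz⟩
  have hc : DifferentiableAt ℂ f c := hf.differentiableAt (ball_mem_nhds c hR)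
  have hD := norm_fderiv_le_of_forall_ball_norm_le hR hf hC
  set h : E → F := fun z => f z - f c - fderiv ℂ f c (z - c) with h_def
  have h0 : h c = 0 := by simp [h_def]
  have hdiff : DifferentiableOn ℂ h (ball c R) := by
    refine (hf.sub_const _).sub ?_
    exact ((fderiv ℂ f c).differentiable.comp (differentiable_id.sub_const c)).differentiableOn
  have hmaps : MapsTo h (ball c R) (closedBall (h c) (4 * C)) := by
    intro w hw
    rw [h0, mem_closedBall_zero_iff]
    have h1 : ‖fderiv ℂ f c (w - c)‖ ≤ 2 * C := by
      have hC0 : 0 ≤ C := (norm_nonneg _).trans (hC c (mem_ball_self hR))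
      calc ‖fderiv ℂ f c (w - c)‖ ≤ 2 * C / R * R := by
            refine (ContinuousLinearMap.le_opNorm _ _).trans ?_
            have : ‖w - c‖ ≤ R := by rw [← dist_eq_norm]; exact (mem_ball.1 hw).le
            gcongr
        _ = 2 * C := by field_simp
    calc ‖h w‖ ≤ ‖f w - f c‖ + ‖fderiv ℂ f c (w - c)‖ := norm_sub_le _ _
      _ ≤ (‖f w‖ + ‖f c‖) + 2 * C := add_le_add (norm_sub_le _ _) h1
      _ ≤ 4 * C := by linarith [hC w hw, hC c (mem_ball_self hR)]
  have hlo : (h · - h c) =o[𝓝 c] (fun w => ‖w - c‖ ^ 1) := by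
    simp only [h0, sub_zero, pow_one]
    exact (hasFDerivAt_iff_isLittleO.1 hc.hasFDerivAt).norm_right
  have := Complex.dist_le_mul_div_pow_of_mapsTo_ball_of_isLittleO hdiff hmaps hlo hz
  rw [h0, dist_zero_right, dist_eq_norm] at this
  exact this

theorem eventually_norm_le_of_differentiableAt (hc : DifferentiableAt ℂ f c) :
    ∀ᶠ r in 𝓝[>] (0 : ℝ), ∀ z ∈ ball c r, ‖f z‖ ≤ ‖f c‖ + 1 := by
  have h1 : ∀ᶠ z in 𝓝 c, ‖f z‖ < ‖f c‖ + 1 :=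
    hc.continuousAt.norm.eventually_lt continuousAt_const (by simp)
  obtain ⟨ε, hε, h⟩ := Metric.eventually_nhds_iff_ball.1 h1
  filter_upwards [Ioo_mem_nhdsGT hε] with r hr z hz
  exact (h z (ball_subset_ball hr.2.le hz)).le

theorem hasFDerivAt_of_forall_ball_norm_sub_sub_le {A : E →L[ℂ] F} {K : ℝ} (hR : 0 < R)
    (h : ∀ z ∈ ball c R, ‖f z - f c - A (z - c)‖ ≤ K * ‖z - c‖ ^ 2) : HasFDerivAt f A c := by
  rw [hasFDerivAt_iff_isLittleO]
  have hO : (fun z => f z - f c - A (z - c)) =O[𝓝 c] fun z => ‖z - c‖ ^ 2 := by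
    refine Asymptotics.IsBigO.of_bound K ?_
    filter_upwards [ball_mem_nhds c hR] with z hz
    rw [Real.norm_of_nonneg (by positivity)]
    exact h z hz
  refine hO.trans_isLittleO ?_
  have hlim : Tendsto (fun z => ‖z - c‖) (𝓝 c) (𝓝 0) := by
    have : Continuous fun z : E => ‖z - c‖ := by fun_prop
    simpa using this.tendsto c
  exact ((Asymptotics.isLittleO_pow_id (𝕜 := ℝ) one_lt_two).comp_tendsto hlim).of_norm_right

/-- A map that is complex differentiable on an open set is continuously differentiable there. -/
theorem DifferentiableOn.continuousAt_fderiv_complex {U : Set E} (hf : DifferentiableOn ℂ f U)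
    (hU : U ∈ 𝓝 c) : ContinuousAt (fderiv ℂ f) c := by
  have hc := hf.differentiableAt hU
  obtain ⟨ε, hε, hεU⟩ := Metric.mem_nhds_iff.1 hU
  obtain ⟨R, hb, hR⟩ := ((eventually_norm_le_of_differentiableAt hc).and
    (Ioo_mem_nhdsGT hε)).exists
  set C := ‖f c‖ + 1
  have hRU : ball c R ⊆ U := (ball_subset_ball hR.2.le).trans hεU
  have hfR := hf.mono hRU
  have key : ∀ x ∈ ball c (R / 2),
      ‖fderiv ℂ f x - fderiv ℂ f c‖ ≤ 32 * C / R ^ 2 * ‖x - c‖ := by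
    intro x hx
    rcases eq_or_ne x c with rfl | hxc
    · simp
    have hd : 0 < ‖x - c‖ := norm_pos_iff.2 (sub_ne_zero.2 hxc)
    rw [mem_ball, dist_eq_norm] at hx
    have hsub : ball x ‖x - c‖ ⊆ ball c (2 * ‖x - c‖) :=
      ball_subset_ball' (by rw [dist_eq_norm]; linarith)
    have hsub' : ball x ‖x - c‖ ⊆ ball c R := hsub.trans (ball_subset_ball (by linarith))
    have hxR : DifferentiableAt ℂ f x :=
      hfR.differentiableAt (isOpen_ball.mem_nhds (hsub' (mem_ball_self hd)))
    have hlin : Differentiable ℂ fun z => fderiv ℂ f c (z - c) :=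
      (fderiv ℂ f c).differentiable.comp (differentiable_id.sub_const c)
    have h1 := norm_fderiv_le_of_forall_ball_norm_le (C := 16 * C * (‖x - c‖ / R) ^ 2) hd
      (f := fun z => f z - f c - fderiv ℂ f c (z - c))
      (((hfR.mono hsub').sub_const _).sub hlin.differentiableOn) (fun z hz => by
        refine (norm_sub_sub_fderiv_le_of_forall_ball_norm_le hfR hb (hsub' hz)).trans ?_
        have hz' : ‖z - c‖ ≤ 2 * ‖x - c‖ := by
          rw [← dist_eq_norm]; exact (mem_ball.1 (hsub hz)).le
        calc 4 * C * (‖z - c‖ / R) ^ 2 ≤ 4 * C * (2 * ‖x - c‖ / R) ^ 2 := by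
              have := hR.1
              gcongr
          _ = _ := by ring)
    have h2 : fderiv ℂ (fun z => f z - f c - fderiv ℂ f c (z - c)) x
        = fderiv ℂ f x - fderiv ℂ f c := by
      have e : HasFDerivAt (fun z => fderiv ℂ f c (z - c)) (fderiv ℂ f c) x := by
        exact (fderiv ℂ f c).hasFDerivAt.comp x ((hasFDerivAt_id x).sub_const c)
      exact ((hxR.hasFDerivAt.sub_const (f c)).sub e).fderiv
    rw [h2] at h1
    refine h1.trans (le_of_eq ?_)
    field_simp
    ring
  have hball : ball c (R / 2) ∈ 𝓝 c := ball_mem_nhds c (half_pos hR.1)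
  rw [ContinuousAt, tendsto_iff_norm_sub_tendsto_zero]
  refine squeeze_zero' (Eventually.of_forall fun _ => norm_nonneg _)
    (eventually_of_mem hball key) ?_
  have : Continuous fun x => 32 * C / R ^ 2 * ‖x - c‖ := by fun_prop
  simpa using this.tendsto c

end CauchyEstimates

/-! ### Limits and parameter integrals of holomorphic maps -/

theorem exists_tendsto_of_forall_dist_le {ι F : Type*} [PseudoMetricSpace F] [CompleteSpace F]
    {l : Filter ι} [l.NeBot] {x : ι → F}
    (h : ∀ ε > 0, ∃ y : ι → F, (∃ a, Tendsto y l (𝓝 a)) ∧ ∀ᶠ i in l, dist (x i) (y i) ≤ ε) :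
    ∃ a, Tendsto x l (𝓝 a) := by
  rw [← cauchy_map_iff_exists_tendsto, Metric.cauchy_iff]
  refine ⟨inferInstance, fun ε hε => ?_⟩
  obtain ⟨y, ⟨a, ha⟩, hy⟩ := h (ε / 5) (by positivity)
  have ha' : ∀ᶠ i in l, dist (y i) a < ε / 5 := ha (ball_mem_nhds a (by positivity))
  refine ⟨_, image_mem_map (hy.and ha'), ?_⟩
  rintro _ ⟨i, ⟨hi, hi'⟩, rfl⟩ _ ⟨j, ⟨hj, hj'⟩, rfl⟩
  have h1 := dist_triangle4 (x i) (y i) (y j) (x j)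
  have h2 := dist_triangle_right (y i) (y j) a
  rw [dist_comm (y j) (x j)] at h1
  linarith

section Limits

variable {E F : Type*} [NormedAddCommGroup E] [NormedSpace ℂ E]
  [NormedAddCommGroup F] [NormedSpace ℂ F] [CompleteSpace F] {c : E} {R C : ℝ}

/-- A pointwise limit of uniformly bounded holomorphic maps is holomorphic, and the derivatives
converge pointwise: the quadratic Taylor estimate survives the limit. -/
theorem differentiableAt_of_tendsto_of_norm_le {ι : Type*} {l : Filter ι} [l.NeBot]
    {q : ι → E → F} {Q : E → F} (hR : 0 < R)
    (hq : ∀ᶠ i in l, DifferentiableOn ℂ (q i) (ball c R) ∧ ∀ z ∈ ball c R, ‖q i z‖ ≤ C)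
    (hlim : ∀ z ∈ ball c R, Tendsto (fun i => q i z) l (𝓝 (Q z))) :
    DifferentiableAt ℂ Q c ∧
      ∀ v, Tendsto (fun i => fderiv ℂ (q i) c v) l (𝓝 (fderiv ℂ Q c v)) := by
  have hC0 : 0 ≤ C := by
    obtain ⟨i, hi⟩ := hq.exists
    exact (norm_nonneg _).trans (hi.2 c (mem_ball_self hR))
  have hball : ∀ v : E, ∀ᶠ ε : ℝ in 𝓝[>] 0, c + (ε : ℂ) • v ∈ ball c R := by
    intro v
    have : Tendsto (fun ε : ℝ => c + (ε : ℂ) • v) (𝓝[>] 0) (𝓝 c) := by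
      have h : Continuous fun ε : ℝ => c + (ε : ℂ) • v := by fun_prop
      simpa using (h.tendsto 0).mono_left nhdsWithin_le_nhds
    exact this (ball_mem_nhds c hR)
  have hex : ∀ v, ∃ a, Tendsto (fun i => fderiv ℂ (q i) c v) l (𝓝 a) := by
    intro v
    refine exists_tendsto_of_forall_dist_le fun δ hδ => ?_
    have hsmall : ∀ᶠ ε : ℝ in 𝓝[>] 0, 4 * C * (‖v‖ / R) ^ 2 * ε < δ := by
      have h : Continuous fun ε : ℝ => 4 * C * (‖v‖ / R) ^ 2 * ε := by fun_prop
      have := (h.tendsto 0).mono_left (nhdsWithin_le_nhds (s := Ioi 0))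
      exact this.eventually_lt_const (by simpa using hδ)
    obtain ⟨ε, ⟨hε, hεδ⟩, hε0⟩ := (((hball v).and hsmall).and self_mem_nhdsWithin).exists
    have hε0 : 0 < ε := hε0
    refine ⟨fun i => (ε : ℂ)⁻¹ • (q i (c + (ε : ℂ) • v) - q i c), ⟨_, ((hlim _ hε).sub
      (hlim _ (mem_ball_self hR))).const_smul _⟩, ?_⟩
    filter_upwards [hq] with i hi
    have h1 := norm_sub_sub_fderiv_le_of_forall_ball_norm_le hi.1 hi.2 hε
    rw [add_sub_cancel_left, map_smul] at h1
    have hne : (ε : ℂ) ≠ 0 := by exact_mod_cast hε0.ne'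
    have h2 : fderiv ℂ (q i) c v - (ε : ℂ)⁻¹ • (q i (c + (ε : ℂ) • v) - q i c)
        = -((ε : ℂ)⁻¹ • (q i (c + (ε : ℂ) • v) - q i c - (ε : ℂ) • fderiv ℂ (q i) c v)) := by
      rw [smul_sub (ε : ℂ)⁻¹ (q i (c + (ε : ℂ) • v) - q i c), inv_smul_smul₀ hne]
      abel
    rw [dist_eq_norm, h2, norm_neg, norm_smul, norm_inv, Complex.norm_real, Real.norm_eq_abs,
      abs_of_pos hε0]
    rw [norm_smul, Complex.norm_real, Real.norm_eq_abs, abs_of_pos hε0] at h1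
    calc ε⁻¹ * _ ≤ ε⁻¹ * (4 * C * (ε * ‖v‖ / R) ^ 2) := by gcongr
      _ = 4 * C * (‖v‖ / R) ^ 2 * ε := by field_simp
      _ ≤ δ := hεδ.le
  choose A hA using hex
  let L : E →ₗ[ℂ] F :=
    { toFun := A
      map_add' := fun x y => tendsto_nhds_unique (hA (x + y)) (by
        simpa only [map_add] using (hA x).add (hA y))
      map_smul' := fun a x => tendsto_nhds_unique (hA (a • x)) (by
        simpa only [map_smul, RingHom.id_apply] using (hA x).const_smul a) }
  have hLbound : ∀ v, ‖L v‖ ≤ 2 * C / R * ‖v‖ := fun v => by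
    refine le_of_tendsto (hA v).norm ?_
    filter_upwards [hq] with i hi
    refine (ContinuousLinearMap.le_opNorm _ _).trans ?_
    gcongr
    exact norm_fderiv_le_of_forall_ball_norm_le hR hi.1 hi.2
  let A' : E →L[ℂ] F := L.mkContinuous (2 * C / R) hLbound
  have hquad : ∀ z ∈ ball c R, ‖Q z - Q c - A' (z - c)‖ ≤ 4 * C * (‖z - c‖ / R) ^ 2 := by
    intro z hz
    refine le_of_tendsto (((hlim z hz).sub (hlim c (mem_ball_self hR))).sub (hA (z - c))).norm ?_
    filter_upwards [hq] with i hi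
    exact norm_sub_sub_fderiv_le_of_forall_ball_norm_le hi.1 hi.2 hz
  have hder : HasFDerivAt Q A' c :=
    hasFDerivAt_of_forall_ball_norm_sub_sub_le hR (K := 4 * C / R ^ 2) fun z hz =>
      (hquad z hz).trans (le_of_eq (by ring))
  refine ⟨hder.differentiableAt, fun v => ?_⟩
  rw [hder.fderiv]
  exact hA v

omit [CompleteSpace F] in
/-- Differentiation under the integral sign for bounded holomorphic integrands. Only the values of
the integrand have to be measurable in the parameter, not its derivative. -/
theorem differentiableAt_integral_of_norm_le {α : Type*} [MeasurableSpace α] {μ : Measure α}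
    [IsFiniteMeasure μ] {G : E → α → F} (hR : 0 < R)
    (hd : ∀ᵐ a ∂μ, DifferentiableOn ℂ (G · a) (ball c R))
    (hC : ∀ᵐ a ∂μ, ∀ z ∈ ball c R, ‖G z a‖ ≤ C)
    (hm : ∀ z ∈ ball c R, AEStronglyMeasurable (G z) μ) :
    DifferentiableAt ℂ (fun z => ∫ a, G z a ∂μ) c ∧
      ∀ v, Integrable (fun a => fderiv ℂ (G · a) c v) μ ∧
        fderiv ℂ (fun z => ∫ a, G z a ∂μ) c v = ∫ a, fderiv ℂ (G · a) c v ∂μ := by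
  have hint : ∀ z ∈ ball c R, Integrable (G z) μ := fun z hz =>
    Integrable.of_bound (hm z hz) C (hC.mono fun a ha => ha z hz)
  have hbound : ∀ᵐ a ∂μ, ‖fderiv ℂ (G · a) c‖ ≤ 2 * C / R := by
    filter_upwards [hd, hC] with a h1 h2
    exact norm_fderiv_le_of_forall_ball_norm_le hR h1 h2
  have hDint : ∀ v, Integrable (fun a => fderiv ℂ (G · a) c v) μ := by
    intro v
    refine Integrable.of_bound (C := 2 * C / R * ‖v‖) ?_ ?_
    · have hseq : ∀ᶠ n : ℕ in atTop, c + ((n : ℂ)⁻¹) • v ∈ ball c R := by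
        have : Tendsto (fun n : ℕ => c + ((n : ℂ)⁻¹) • v) atTop (𝓝 (c + (0 : ℂ) • v)) :=
          tendsto_const_nhds.add (tendsto_inv_atTop_nhds_zero_nat.smul_const v)
        rw [zero_smul, add_zero] at this
        exact this (ball_mem_nhds c hR)
      obtain ⟨N, hN⟩ := eventually_atTop.1 hseq
      refine aestronglyMeasurable_of_tendsto_ae atTop
        (f := fun (n : ℕ) a => ((n + N : ℕ) : ℂ) • (G (c + ((n + N : ℕ) : ℂ)⁻¹ • v) a - G c a))
        (fun n => ((hm _ (hN _ (by omega))).sub (hm c (mem_ball_self hR))).const_smul _) ?_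
      filter_upwards [hd] with a ha
      refine (ha.differentiableAt (ball_mem_nhds c hR)).hasFDerivAt.lim v ?_
      simp only [Complex.norm_natCast]
      exact tendsto_natCast_atTop_atTop.comp (tendsto_add_atTop_nat N)
    · filter_upwards [hbound] with a ha
      exact (ContinuousLinearMap.le_opNorm _ _).trans (by gcongr)
  let L : E →ₗ[ℂ] F :=
    { toFun := fun v => ∫ a, fderiv ℂ (G · a) c v ∂μ
      map_add' := fun x y => by simp only [map_add, integral_add (hDint x) (hDint y)]
      map_smul' := fun k x => by simp only [map_smul, integral_smul, RingHom.id_apply] }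
  let A : E →L[ℂ] F := L.mkContinuous (2 * C / R * μ.real univ) fun v => by
    refine (norm_integral_le_of_norm_le_const (C := 2 * C / R * ‖v‖) ?_).trans (le_of_eq (by ring))
    filter_upwards [hbound] with a ha
    exact (ContinuousLinearMap.le_opNorm _ _).trans (by gcongr)
  have hder : HasFDerivAt (fun z => ∫ a, G z a ∂μ) A c := by
    refine hasFDerivAt_of_forall_ball_norm_sub_sub_le hR
      (K := 4 * C / R ^ 2 * μ.real univ) fun z hz => ?_
    have hcc := hint c (mem_ball_self hR)
    have e : (∫ a, G z a ∂μ) - (∫ a, G c a ∂μ) - A (z - c)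
        = ∫ a, (G z a - G c a - fderiv ℂ (G · a) c (z - c)) ∂μ := by
      have hzc : Integrable (fun a => G z a - G c a) μ := (hint z hz).sub hcc
      rw [integral_sub hzc (hDint _), integral_sub (hint z hz) hcc]
      rfl
    rw [e]
    refine (norm_integral_le_of_norm_le_const (C := 4 * C * (‖z - c‖ / R) ^ 2) ?_).trans
      (le_of_eq (by ring))
    filter_upwards [hd, hC] with a h1 h2
    exact norm_sub_sub_fderiv_le_of_forall_ball_norm_le h1 h2 hz
  refine ⟨hder.differentiableAt, fun v => ⟨hDint v, ?_⟩⟩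
  rw [hder.fderiv]
  rfl

end Limits

/-! ### Biholomorphic maps and the identity theorem on the unit ball -/

section UnitBall

variable {E : Type*} [NormedAddCommGroup E]

theorem mem_unitBall {z : E} : z ∈ unitBall E ↔ ‖z‖ < 1 := mem_ball_zero_iff

theorem isOpen_unitBall : IsOpen (unitBall E) := isOpen_ball

theorem zero_mem_unitBall : (0 : E) ∈ unitBall E := mem_ball_self one_pos

theorem unitBall_mem_nhds {z : E} (hz : z ∈ unitBall E) : unitBall E ∈ 𝓝 z :=
  isOpen_unitBall.mem_nhds hz

variable [NormedSpace ℂ E]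

theorem DifferentiableOn.differentiableAt_unitBall {F : Type*} [NormedAddCommGroup F]
    [NormedSpace ℂ F] {f : E → F} (hf : DifferentiableOn ℂ f (unitBall E)) {z : E}
    (hz : z ∈ unitBall E) : DifferentiableAt ℂ f z :=
  hf.differentiableAt (unitBall_mem_nhds hz)

theorem isBiholomorphicOnBall_of_injOn [FiniteDimensional ℂ E] {f : E → E}
    (hf : DifferentiableOn ℂ f (unitBall E)) (hinj : InjOn f (unitBall E))
    (hker : ∀ z ∈ unitBall E, Function.Injective (fderiv ℂ f z)) : IsBiholomorphicOnBall f := by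
  have := FiniteDimensional.complete ℂ E
  have hstrict : ∀ z ∈ unitBall E, ∃ f' : E ≃L[ℂ] E, HasStrictFDerivAt f (f' : E →L[ℂ] E) z := by
    intro z hz
    refine ⟨(LinearEquiv.ofInjectiveEndo (fderiv ℂ f z : E →ₗ[ℂ] E)
      (hker z hz)).toContinuousLinearEquiv, ?_⟩
    have h := hasStrictFDerivAt_of_hasFDerivAt_of_continuousAt
      (f := f) (f' := fderiv ℂ f) (x := z)
      (eventually_of_mem (unitBall_mem_nhds hz) fun x hx =>
        (hf.differentiableAt_unitBall hx).hasFDerivAt)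
      (hf.continuousAt_fderiv_complex (unitBall_mem_nhds hz))
    convert! h
  refine ⟨hf, ?_, Function.invFunOn f (unitBall E), ?_, fun z hz => hinj.leftInvOn_invFunOn hz⟩
  · rw [isOpen_iff_mem_nhds]
    rintro _ ⟨z, hz, rfl⟩
    obtain ⟨f', hf'⟩ := hstrict z hz
    rw [← hf'.map_nhds_eq_of_equiv]
    exact image_mem_map (unitBall_mem_nhds hz)
  · rintro _ ⟨z, hz, rfl⟩
    obtain ⟨f', hf'⟩ := hstrict z hz
    have h := hf'.to_local_left_inverse (eventually_of_mem (unitBall_mem_nhds hz)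
      fun x hx => hinj.leftInvOn_invFunOn hx)
    exact h.differentiableAt.differentiableWithinAt

theorem eqOn_zero_unitBall_of_eqOn_zero_ball {f : E → E} [CompleteSpace E]
    (hf : DifferentiableOn ℂ f (unitBall E)) {c : E} (hc : c ∈ unitBall E) {r : ℝ} (hr : 0 < r)
    (h0 : ∀ z ∈ ball c r, f z = 0) {z : E} (hz : z ∈ unitBall E) : f z = 0 := by
  set L : ℂ → E := fun ζ => c + ζ • (z - c) with hL
  have hLc : Continuous L := by fun_prop
  have hLd : Differentiable ℂ L := by fun_prop
  set U : Set ℂ := L ⁻¹' unitBall E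
  have hU : IsOpen U := isOpen_unitBall.preimage hLc
  have hUconv : Convex ℝ U := by
    have h := convex_ball (E := E) 0 1
    intro x hx y hy a b ha hb hab
    have e : L (a • x + b • y) = a • L x + b • L y := by
      simp only [hL, Complex.real_smul]
      have hab' : (a : ℂ) + b = 1 := by exact_mod_cast hab
      have : c = ((a : ℂ) + b) • c := by rw [hab', one_smul]
      rw [← Complex.coe_smul, ← Complex.coe_smul]
      nth_rewrite 1 [this]
      module
    show L _ ∈ ball (0 : E) 1
    rw [e]
    exact h hx hy ha hb hab
  have hana : AnalyticOnNhd ℂ (f ∘ L) U :=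
    (hf.comp hLd.differentiableOn fun _ h => h).analyticOnNhd hU
  have h0U : (0 : ℂ) ∈ U := by simpa [U, hL] using hc
  have h1U : (1 : ℂ) ∈ U := by simpa [U, hL] using hz
  have hev : f ∘ L =ᶠ[𝓝 0] 0 := by
    have : L ⁻¹' ball c r ∈ 𝓝 (0 : ℂ) :=
      hLc.continuousAt.preimage_mem_nhds (by simpa [hL] using ball_mem_nhds c hr)
    filter_upwards [this] with ζ hζ using h0 _ hζ
  have := hana.eqOn_zero_of_preconnected_of_eventuallyEq_zero hUconv.isPreconnected h0U hev h1U
  simpa [hL] using this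

end UnitBall

/-! ### Norm bounds from the numerical range -/

section NumericalRange

variable {E : Type*} [NormedAddCommGroup E] [NormedSpace ℂ E]

theorem DifferentiableOn.exists_norm_le_closedBall [FiniteDimensional ℂ E] {h : E → E}
    (hh : DifferentiableOn ℂ h (unitBall E)) {ρ : ℝ} (hρ : ρ < 1) :
    ∃ C, 0 ≤ C ∧ ∀ z ∈ closedBall (0 : E) ρ, ‖h z‖ ≤ C := by
  have := FiniteDimensional.proper ℂ E
  obtain ⟨C, hC⟩ := (isCompact_closedBall (0 : E) ρ).exists_bound_of_continuousOn
    (hh.continuousOn.mono (closedBall_subset_ball hρ))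
  exact ⟨max C 0, le_max_right _ _, fun z hz => (hC z hz).trans (le_max_left _ _)⟩

theorem norm_add_smul_le_of_numericalRange {h : E → E} {ρ v C L : ℝ} {w : E} {ε : ℂ}
    (hv : 0 ≤ v) (hC0 : 0 ≤ C) (hL0 : 0 ≤ L)
    (hnum : ∀ z, ‖z‖ ≤ ρ → z ≠ 0 → ∀ l : E →L[ℂ] ℂ, l z = (‖z‖ : ℂ) → ‖l‖ = 1 → ‖l (h z)‖ ≤ v)
    (hC : ∀ z, ‖z‖ ≤ ρ → ‖h z‖ ≤ C)
    (hL : ∀ x y, ‖x‖ ≤ ρ → ‖y‖ ≤ ρ → ‖h y - h x‖ ≤ L * ‖y - x‖)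
    (hw : ‖w‖ + ‖ε‖ * C ≤ ρ) :
    ‖w + ε • h w‖ ≤ ‖w‖ + (‖ε‖ * v + ‖ε‖ ^ 2 * (L * C)) := by
  rcases eq_or_ne (w + ε • h w) 0 with h0 | h0
  · rw [h0, norm_zero]
    positivity
  have hwρ : ‖w‖ ≤ ρ := le_trans (le_add_of_nonneg_right (by positivity)) hw
  have hstep : ‖ε • h w‖ ≤ ‖ε‖ * C := by
    rw [norm_smul]
    gcongr
    exact hC w hwρ
  have hw'ρ : ‖w + ε • h w‖ ≤ ρ := (norm_add_le _ _).trans (by linarith)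
  obtain ⟨l, hl1, hl⟩ := exists_dual_vector ℂ (w + ε • h w) (norm_ne_zero_iff.2 h0)
  have hle : ∀ x, ‖l x‖ ≤ ‖x‖ := fun x => by simpa [hl1] using l.le_opNorm x
  -- the functional that norms the new point sees `h` at the new point, up to a Lipschitz error
  have e : l (w + ε • h w)
      = l w + ε * l (h (w + ε • h w)) + ε * l (h w - h (w + ε • h w)) := by
    simp only [map_add, map_smul, map_sub, smul_eq_mul]
    ring
  have hn : ‖w + ε • h w‖ = ‖l (w + ε • h w)‖ := by
    rw [hl]; simp
  have h1 : ‖l (h w - h (w + ε • h w))‖ ≤ L * (‖ε‖ * C) := by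
    refine (hle _).trans ((hL _ _ hw'ρ hwρ).trans ?_)
    gcongr
    rwa [sub_add_cancel_left, norm_neg]
  have h2 := hnum _ hw'ρ h0 l hl hl1
  calc ‖w + ε • h w‖ = ‖l (w + ε • h w)‖ := hn
    _ ≤ ‖l w‖ + ‖ε * l (h (w + ε • h w))‖ + ‖ε * l (h w - h (w + ε • h w))‖ := by
        rw [e]; exact norm_add₃_le
    _ ≤ ‖w‖ + ‖ε‖ * v + ‖ε‖ * (L * (‖ε‖ * C)) := by
        rw [norm_mul, norm_mul]
        gcongr
        exact hle w
    _ = _ := by ring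

/-- A holomorphic map is bounded in norm by its numerical range, on a smaller ball. The iterates
`(id + (ζ / k) h)^[k] z` approximate the complex-time flow of `h`; the bound on the numerical range
keeps them in the ball for `|ζ| < R`, and their derivative in `ζ` at `0` is `h z`. -/
theorem norm_le_of_numericalRange [FiniteDimensional ℂ E] {h : E → E}
    (hh : DifferentiableOn ℂ h (unitBall E)) {r ρ v : ℝ} (hrρ : r < ρ) (hρ : ρ < 1) (hv : 0 < v)
    (hnum : ∀ z, ‖z‖ ≤ ρ → z ≠ 0 → ∀ l : E →L[ℂ] ℂ, l z = (‖z‖ : ℂ) → ‖l‖ = 1 → ‖l (h z)‖ ≤ v)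
    {z : E} (hz : ‖z‖ ≤ r) : ‖h z‖ ≤ 4 * v / (ρ - r) := by
  have := FiniteDimensional.complete ℂ E
  obtain ⟨C, hC0, hC⟩ := hh.exists_norm_le_closedBall hρ
  obtain ⟨C', hC'0, hC'⟩ := hh.exists_norm_le_closedBall (ρ := (1 + ρ) / 2) (by linarith)
  simp only [mem_closedBall_zero_iff] at hC
  set L := 2 * C' / ((1 + ρ) / 2 - ρ) with hL_def
  have hL0 : 0 ≤ L := div_nonneg (by positivity) (by linarith)
  have hL : ∀ x y, ‖x‖ ≤ ρ → ‖y‖ ≤ ρ → ‖h y - h x‖ ≤ L * ‖y - x‖ := fun x y hx hy =>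
    norm_sub_le_of_forall_ball_norm_le (by linarith)
      (hh.mono (ball_subset_ball (by linarith))) (fun w hw => hC' w (ball_subset_closedBall hw))
      (mem_closedBall_zero_iff.2 hx) (mem_closedBall_zero_iff.2 hy)
  set R := (ρ - r) / (2 * v) with hR_def
  have hR : 0 < R := div_pos (by linarith) (by positivity)
  have hRv : R * v = (ρ - r) / 2 := by rw [hR_def]; field_simp
  -- the number of steps is chosen so that the total discretization error is at most `(ρ - r) / 2`
  obtain ⟨k, hk⟩ := exists_nat_gt (max 1 ((R ^ 2 * (L * C) + R * C) / ((ρ - r) / 2)))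
  have hk1 : (1 : ℝ) < k := (le_max_left _ _).trans_lt hk
  have hk0 : (0 : ℝ) < k := by linarith
  have hkk : R ^ 2 * (L * C) + R * C < k * ((ρ - r) / 2) :=
    (div_lt_iff₀ (by linarith)).1 ((le_max_right _ _).trans_lt hk)
  set d := R / k * v + (R / k) ^ 2 * (L * C) with hd_def
  have hd0 : 0 ≤ d := by positivity
  have hkd : k * d + R / k * C ≤ ρ - r := by
    have e : k * d + R / k * C = R * v + (R ^ 2 * (L * C) + R * C) / k := by
      rw [hd_def]; field_simp; ring
    rw [e, hRv]
    have : (R ^ 2 * (L * C) + R * C) / k ≤ (ρ - r) / 2 := (div_le_iff₀ hk0).2 (by linarith)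
    linarith
  let G : ℕ → ℂ → E := fun j => j.rec (fun _ => z) fun _ g ζ => g ζ + (ζ / k) • h (g ζ)
  have hGs : ∀ j ζ, G (j + 1) ζ = G j ζ + (ζ / k) • h (G j ζ) := fun j ζ => rfl
  have hεR : ∀ ζ ∈ ball (0 : ℂ) R, ‖ζ / k‖ ≤ R / k := fun ζ hζ => by
    rw [norm_div, Complex.norm_natCast]
    have := (mem_ball_zero_iff.1 hζ).le
    gcongr
  have hroom : ∀ j : ℕ, j ≤ k → r + j * d + R / k * C ≤ ρ := fun j hj => by
    have : (j : ℝ) * d ≤ k * d := by gcongr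
    linarith
  have hroom' : ∀ j : ℕ, j ≤ k → r + j * d ≤ ρ := fun j hj => by
    have : 0 ≤ R / k * C := by positivity
    linarith [hroom j hj]
  have hGbound : ∀ j ≤ k, ∀ ζ ∈ ball (0 : ℂ) R, ‖G j ζ‖ ≤ r + j * d := by
    intro j
    induction j with
    | zero => intro _ ζ _; simpa [G] using hz
    | succ j ih =>
      intro hj ζ hζ
      have hj' : j ≤ k := by omega
      have h1 := ih hj' ζ hζ
      have h2 := hεR ζ hζ
      have h3 : ‖ζ / k‖ * C ≤ R / k * C := by gcongr
      have h4 := norm_add_smul_le_of_numericalRange hv.le hC0 hL0 hnum hC hL (w := G j ζ)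
        (ε := ζ / k) (by linarith [hroom j hj'])
      rw [hGs]
      have h5 : ‖ζ / k‖ * v + ‖ζ / k‖ ^ 2 * (L * C) ≤ d := by
        rw [hd_def]; gcongr
      push_cast
      linarith
  have hGball : ∀ j ≤ k, ∀ ζ ∈ ball (0 : ℂ) R, G j ζ ∈ unitBall E := fun j hj ζ hζ =>
    mem_unitBall.2 (by linarith [hGbound j hj ζ hζ, hroom' j hj])
  have hGdiff : ∀ j ≤ k, DifferentiableOn ℂ (G j) (ball 0 R) := by
    intro j
    induction j with
    | zero => intro _; exact differentiableOn_const _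
    | succ j ih =>
      intro hj
      have h1 := ih (by omega)
      exact h1.add ((differentiableOn_id.div_const _).smul
        (hh.comp h1 fun ζ hζ => hGball j (by omega) ζ hζ))
  have hG0 : ∀ j, G j 0 = z := by
    intro j
    induction j with
    | zero => rfl
    | succ j ih => rw [hGs, zero_div, zero_smul, add_zero, ih]
  have hGder : ∀ j ≤ k, HasDerivAt (G j) (((j : ℂ) / k) • h z) 0 := by
    intro j
    induction j with
    | zero =>
      intro _
      rw [Nat.cast_zero, zero_div, zero_smul]
      exact hasDerivAt_const (0 : ℂ) z
    | succ j ih =>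
      intro hj
      have h1 := ih (by omega)
      have hd1 : DifferentiableAt ℂ (fun ζ => h (G j ζ)) 0 :=
        (hh.comp (hGdiff j (by omega)) fun ζ hζ => hGball j (by omega) ζ hζ).differentiableAt
          (ball_mem_nhds 0 hR)
      have h2 := h1.add (((hasDerivAt_id (0 : ℂ)).div_const (k : ℂ)).smul hd1.hasDerivAt)
      convert! h2 using 1
      simp only [id_eq, zero_div, zero_smul, zero_add, hG0]
      push_cast
      rw [← add_smul]
      congr 1
      ring
  have hfin := norm_fderiv_le_of_forall_ball_norm_le hR (hGdiff k le_rfl) (C := 1)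
    fun ζ hζ => (mem_unitBall.1 (hGball k le_rfl ζ hζ)).le
  rw [← norm_deriv_eq_norm_fderiv, (hGder k le_rfl).deriv,
    div_self (by exact_mod_cast hk0.ne'), one_smul] at hfin
  refine hfin.trans (le_of_eq ?_)
  rw [hR_def]
  field_simp
  ring

/-- Restricting `h` to a complex line through the origin and dividing by the parameter gives a
function of one variable whose real part is bounded above. -/
theorem exists_slice_of_re_nonpos {h : E → E} (hh : DifferentiableOn ℂ h (unitBall E))
    (h0 : h 0 = 0) {c : ℝ} (hc : 0 ≤ c)
    (hD : fderiv ℂ h 0 = -((c : ℂ) • ContinuousLinearMap.id ℂ E))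
    (hre : ∀ z ∈ unitBall E, z ≠ 0 → ∀ l : E →L[ℂ] ℂ, l z = (‖z‖ : ℂ) → ‖l‖ = 1 →
      (l (h z)).re ≤ 0)
    {z : E} (hz0 : z ≠ 0) {l : E →L[ℂ] ℂ} (hlz : l z = (‖z‖ : ℂ)) (hl : ‖l‖ = 1) :
    ∃ q : ℂ → ℂ, DifferentiableOn ℂ q (ball 0 1) ∧ q 0 = 0 ∧ (∀ ζ ∈ ball (0 : ℂ) 1, (q ζ).re ≤ c) ∧
      l (h z) = ‖z‖ * (q ‖z‖ - c) := by
  have hn : (‖z‖ : ℂ) ≠ 0 := by exact_mod_cast (norm_ne_zero_iff.2 hz0)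
  set u : E := (‖z‖ : ℂ)⁻¹ • z with hu
  have hu1 : ‖u‖ = 1 := by
    rw [hu, norm_smul, norm_inv, Complex.norm_real, norm_norm,
      inv_mul_cancel₀ (norm_ne_zero_iff.2 hz0)]
  have hlu : l u = 1 := by rw [hu, map_smul, hlz, smul_eq_mul, inv_mul_cancel₀ hn]
  have hmem : ∀ ζ ∈ ball (0 : ℂ) 1, ζ • u ∈ unitBall E := fun ζ hζ => by
    rw [mem_unitBall, norm_smul, hu1, mul_one]; exact mem_ball_zero_iff.1 hζ
  set g : ℂ → ℂ := fun ζ => l (h (ζ • u)) with hg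
  have hgd : DifferentiableOn ℂ g (ball 0 1) :=
    l.differentiable.comp_differentiableOn
      (hh.comp (differentiable_id.smul_const u).differentiableOn hmem)
  have hg0 : g 0 = 0 := by simp [hg, h0]
  have hgder : deriv g 0 = -c := by
    have h1 : HasFDerivAt h (fderiv ℂ h 0) ((0 : ℂ) • u) := by
      rw [zero_smul]
      exact (hh.differentiableAt_unitBall zero_mem_unitBall).hasFDerivAt
    have h2 := h1.comp_hasDerivAt (0 : ℂ) ((hasDerivAt_id (0 : ℂ)).smul_const u)
    have h3 := l.hasFDerivAt.comp_hasDerivAt (0 : ℂ) h2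
    have h4 : deriv g 0 = _ := h3.deriv
    rw [h4, hD]
    simp [hlu]
  refine ⟨fun ζ => dslope g 0 ζ + c, ?_, ?_, ?_, ?_⟩
  · exact ((Complex.differentiableOn_dslope (ball_mem_nhds 0 one_pos)).2 hgd).add_const _
  · simp [hgder]
  · intro ζ hζ
    suffices (dslope g 0 ζ).re ≤ 0 by simpa using this
    rcases eq_or_ne ζ 0 with rfl | hζ0
    · simpa [hgder] using hc
    have hζn : (‖ζ‖ : ℂ) ≠ 0 := by exact_mod_cast (norm_ne_zero_iff.2 hζ0)
    have hζr : ‖ζ‖ ≠ 0 := norm_ne_zero_iff.2 hζ0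
    -- rotating the norming functional of `u` gives a norming functional of `ζ • u`
    have h1 := hre (ζ • u) (hmem ζ hζ) (smul_ne_zero hζ0 (by rw [← norm_ne_zero_iff, hu1]; simp))
      (((‖ζ‖ : ℂ) / ζ) • l) (by simp [hlu, norm_smul, hu1, mul_div_cancel₀ _ hζ0])
      (by rw [norm_smul, hl, norm_div, Complex.norm_real, norm_norm, div_self hζr, one_mul])
    rw [dslope_of_ne _ hζ0, slope_def_field, hg0, sub_zero, sub_zero]
    have e : ((‖ζ‖ : ℂ) / ζ) • l (h (ζ • u)) = (‖ζ‖ : ℝ) * (g ζ / ζ) := by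
      simp only [hg, smul_eq_mul]; ring
    rw [smul_apply, e, Complex.re_ofReal_mul] at h1
    have : 0 < ‖ζ‖ := norm_pos_iff.2 hζ0
    exact nonpos_of_mul_nonpos_right h1 this
  · have e : (‖z‖ : ℂ) • u = z := by rw [hu, smul_inv_smul₀ hn]
    simp only [dslope_of_ne _ hn, slope_def_field, hg0, sub_zero, add_sub_cancel_right]
    rw [mul_div_cancel₀ _ hn, hg]
    simp only [e]

/-- The growth estimate for dissipative maps: it applies to Herglotz functions (`c = 1`) and to
`φ - id` for a Schwarz map `φ` with `Dφ(0) = (1 - c) I`. -/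
theorem norm_le_of_re_nonpos [FiniteDimensional ℂ E] {h : E → E}
    (hh : DifferentiableOn ℂ h (unitBall E)) (h0 : h 0 = 0) {c : ℝ} (hc : 0 ≤ c)
    (hD : fderiv ℂ h 0 = -((c : ℂ) • ContinuousLinearMap.id ℂ E))
    (hre : ∀ z ∈ unitBall E, z ≠ 0 → ∀ l : E →L[ℂ] ℂ, l z = (‖z‖ : ℂ) → ‖l‖ = 1 →
      (l (h z)).re ≤ 0)
    {r : ℝ} (hr : r < 1) {z : E} (hz : ‖z‖ ≤ r) : ‖h z‖ ≤ 48 / (1 - r) ^ 2 * c := by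
  have hr0 : 0 ≤ r := (norm_nonneg z).trans hz
  have h1r : 0 < 1 - r := by linarith
  set ρ := (1 + r) / 2 with hρ
  have key : ∀ ε > 0, ‖h z‖ ≤ 48 / (1 - r) ^ 2 * (c + ε) := by
    intro ε hε
    have hM : 0 < c + ε := by linarith
    refine (norm_le_of_numericalRange (v := 3 * (c + ε) / (1 - ρ)) hh (r := r) (ρ := ρ)
      (by linarith) (by linarith) (div_pos (by linarith) (by linarith)) ?_ hz).trans (le_of_eq ?_)
    · intro w hw hw0 l hlw hl
      obtain ⟨q, hq, hq0, hqre, hqw⟩ := exists_slice_of_re_nonpos hh h0 hc hD hre hw0 hlw hl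
      have hw1 : ‖w‖ < 1 := by linarith
      have hn : ‖(‖w‖ : ℂ)‖ = ‖w‖ := by simp
      have hB := Complex.borelCaratheodory_zero hM hq
        (fun ζ hζ => (hqre ζ hζ).trans (by linarith : c ≤ c + ε)) one_pos
        (z := (‖w‖ : ℂ)) (by rw [mem_ball_zero_iff, hn]; exact hw1) hq0
      rw [hn] at hB
      have hB' : ‖q ‖w‖‖ ≤ 2 * (c + ε) / (1 - ρ) := by
        refine hB.trans ?_
        have h2 : 0 < 1 - ρ := by linarith
        have h3 : 2 * (c + ε) * ‖w‖ ≤ 2 * (c + ε) := mul_le_of_le_one_right (by linarith) hw1.le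
        exact div_le_div₀ (by linarith) h3 h2 (by linarith)
      have h4 : c + ε ≤ (c + ε) / (1 - ρ) := by
        rw [le_div_iff₀ (by linarith)]
        exact mul_le_of_le_one_right hM.le (by linarith)
      rw [hqw, norm_mul, hn]
      calc ‖w‖ * ‖q ‖w‖ - c‖ ≤ 1 * (‖q ‖w‖‖ + ‖(c : ℂ)‖) := by
            gcongr
            exact norm_sub_le _ _
        _ ≤ 2 * (c + ε) / (1 - ρ) + (c + ε) / (1 - ρ) := by
            rw [one_mul, Complex.norm_real, Real.norm_of_nonneg hc]
            linarith
        _ = _ := by ring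
    · have e1 : 1 - ρ = (1 - r) / 2 := by rw [hρ]; ring
      have e2 : ρ - r = (1 - r) / 2 := by rw [hρ]; ring
      rw [e1, e2]
      field_simp
      ring
  refine le_of_forall_pos_le_add fun δ hδ => ?_
  refine (key (δ * (1 - r) ^ 2 / 48) (by positivity)).trans (le_of_eq ?_)
  field_simp

/-- For holomorphic maps with `Dh(0) = -I`, the weak inequality `Re l(h z) ≤ 0` is automatically
strict, by the maximum principle on slices. -/
theorem re_neg_of_re_nonpos {h : E → E} (hh : DifferentiableOn ℂ h (unitBall E)) (h0 : h 0 = 0)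
    (hD : fderiv ℂ h 0 = -ContinuousLinearMap.id ℂ E)
    (hre : ∀ z ∈ unitBall E, z ≠ 0 → ∀ l : E →L[ℂ] ℂ, l z = (‖z‖ : ℂ) → ‖l‖ = 1 →
      (l (h z)).re ≤ 0)
    {z : E} (hz : z ∈ unitBall E) (hz0 : z ≠ 0) {l : E →L[ℂ] ℂ} (hlz : l z = (‖z‖ : ℂ))
    (hl : ‖l‖ = 1) : (l (h z)).re < 0 := by
  obtain ⟨q, hq, hq0, hqre, hqz⟩ := exists_slice_of_re_nonpos hh h0 zero_le_one
    (by rw [hD, Complex.ofReal_one, one_smul]) hre hz0 hlz hl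
  refine lt_of_le_of_ne (hre z hz hz0 l hlz hl) fun heq => ?_
  have hpos : 0 < ‖z‖ := norm_pos_iff.2 hz0
  have hzb : (‖z‖ : ℂ) ∈ ball (0 : ℂ) 1 := by
    rw [mem_ball_zero_iff]; simpa using mem_unitBall.1 hz
  have hq1 : (q ‖z‖).re = 1 := by
    rw [hqz, Complex.re_ofReal_mul] at heq
    have := (mul_eq_zero.1 heq).resolve_left hpos.ne'
    simpa [sub_eq_zero] using this
  have hmax : IsMaxOn (norm ∘ fun ζ => Complex.exp (q ζ)) (ball 0 1) (‖z‖ : ℂ) := by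
    intro ζ hζ
    simp only [mem_ofPred_eq, Function.comp_apply, Complex.norm_exp, hq1]
    exact Real.exp_le_exp.2 (hqre ζ hζ)
  have := Complex.norm_eqOn_of_isPreconnected_of_isMaxOn (convex_ball (0 : ℂ) 1).isPreconnected
    isOpen_ball hq.cexp hzb hmax (mem_ball_self one_pos)
  simp only [Function.comp_apply, Function.const_apply, Complex.norm_exp, hq0, hq1,
    Complex.zero_re, Real.exp_eq_exp] at this
  exact zero_ne_one this

end NumericalRange

/-! ### Schwarz maps close to the identity -/

section SchwarzMap

variable {E : Type*} [NormedAddCommGroup E] [NormedSpace ℂ E]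

/-- A holomorphic self-map of the unit ball that fixes the origin and has derivative `a I` there. -/
structure IsSchwarzMap (φ : E → E) (a : ℝ) : Prop where
  differentiableOn : DifferentiableOn ℂ φ (unitBall E)
  mapsTo : MapsTo φ (unitBall E) (unitBall E)
  map_zero : φ 0 = 0
  fderiv_zero : fderiv ℂ φ 0 = (a : ℂ) • ContinuousLinearMap.id ℂ E

namespace IsSchwarzMap

variable {φ ψ : E → E} {a b r : ℝ} {z w : E}

theorem norm_le (h : IsSchwarzMap φ a) (hz : z ∈ unitBall E) : ‖φ z‖ ≤ ‖z‖ :=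
  Complex.norm_le_norm_of_mapsTo_ball h.differentiableOn
    (fun _ hx => ball_subset_closedBall (h.mapsTo hx)) h.map_zero (mem_unitBall.1 hz)

theorem norm_sub_le (h : IsSchwarzMap φ a) (hr : r < 1) (hz : ‖z‖ ≤ r) (hw : ‖w‖ ≤ r) :
    ‖φ z - φ w‖ ≤ 2 / (1 - r) * ‖z - w‖ := by
  have := norm_sub_le_of_forall_ball_norm_le hr h.differentiableOn
    (fun x hx => (mem_unitBall.1 (h.mapsTo hx)).le) (mem_closedBall_zero_iff.2 hw)
    (mem_closedBall_zero_iff.2 hz)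
  rwa [mul_one] at this

theorem re_sub_nonpos (h : IsSchwarzMap φ a) (hz : z ∈ unitBall E) {l : E →L[ℂ] ℂ}
    (hlz : l z = (‖z‖ : ℂ)) (hl : ‖l‖ = 1) : (l (φ z - z)).re ≤ 0 := by
  have h1 : ‖l (φ z)‖ ≤ ‖φ z‖ := by simpa [hl] using l.le_opNorm (φ z)
  have h2 := (Complex.re_le_norm (l (φ z))).trans (h1.trans (h.norm_le hz))
  rw [map_sub, hlz, Complex.sub_re, Complex.ofReal_re]
  linarith

variable [FiniteDimensional ℂ E]

theorem norm_sub_self_le (h : IsSchwarzMap φ a) (ha : a ≤ 1) (hr : r < 1) (hz : ‖z‖ ≤ r) :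
    ‖φ z - z‖ ≤ 48 / (1 - r) ^ 2 * (1 - a) := by
  refine norm_le_of_re_nonpos (h := fun z => φ z - z) (h.differentiableOn.sub differentiableOn_id)
    (by simp [h.map_zero]) (by linarith) ?_
    (fun w hw _ l hlw hl => h.re_sub_nonpos hw hlw hl) hr hz
  have h1 := ((h.differentiableOn.differentiableAt_unitBall zero_mem_unitBall).hasFDerivAt).sub
    (hasFDerivAt_id (0 : E))
  rw [h.fderiv_zero] at h1
  refine h1.fderiv.trans ?_
  push_cast
  module

/-- On a given smaller ball, a Schwarz map is injective, with injective derivative, as soon as its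
derivative at the origin is close enough to the identity. -/
theorem injOn_closedBall (h : IsSchwarzMap φ a) (ha : a ≤ 1) (hr : r < 1)
    (har : 1 - a ≤ (1 - r) ^ 3 / 1536) :
    InjOn φ (closedBall 0 r) ∧ ∀ z ∈ closedBall (0 : E) r, Function.Injective (fderiv ℂ φ z) := by
  have h1r : 0 < 1 - r := by linarith
  set r' := (1 + r) / 2 with hr'
  set C := 48 / (1 - r') ^ 2 * (1 - a) with hC
  set g : E → E := fun z => φ z - z with hg
  have hball : ball (0 : E) r' ⊆ unitBall E := ball_subset_ball (by linarith)
  have hgd : DifferentiableOn ℂ g (ball 0 r') :=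
    (h.differentiableOn.mono hball).sub differentiableOn_id
  have hgb : ∀ z ∈ ball (0 : E) r', ‖g z‖ ≤ C := fun z hz =>
    h.norm_sub_self_le ha (by linarith) (mem_ball_zero_iff.1 hz).le
  have hhalf : 2 * C / (r' - r) ≤ 1 / 2 := by
    have e : 2 * C / (r' - r) = 768 * (1 - a) / (1 - r) ^ 3 := by
      have e1 : 1 - r' = (1 - r) / 2 := by rw [hr']; ring
      have e2 : r' - r = (1 - r) / 2 := by rw [hr']; ring
      rw [hC, e1, e2]
      field_simp
      ring
    rw [e, div_le_iff₀ (by positivity)]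
    linarith
  refine ⟨fun z hz w hw hzw => ?_, fun z hz => ?_⟩
  · have h1 := norm_sub_le_of_forall_ball_norm_le (by linarith) hgd hgb hz hw
    have e : g w - g z = -(w - z) := by simp only [hg, hzw]; abel
    rw [e, norm_neg] at h1
    have h2 : ‖w - z‖ ≤ 1 / 2 * ‖w - z‖ := h1.trans (by gcongr)
    have h3 : ‖w - z‖ = 0 := le_antisymm (by linarith) (norm_nonneg _)
    exact (sub_eq_zero.1 (norm_eq_zero.1 h3)).symm
  · have hzU : z ∈ unitBall E := closedBall_subset_ball hr hz
    have hsub : ball z (r' - r) ⊆ ball 0 r' :=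
      ball_subset_ball' (by rw [mem_closedBall] at hz; linarith)
    have h1 := norm_fderiv_le_of_forall_ball_norm_le (by linarith) (hgd.mono hsub)
      fun w hw => hgb w (hsub hw)
    have h2 : fderiv ℂ g z = fderiv ℂ φ z - ContinuousLinearMap.id ℂ E :=
      ((h.differentiableOn.differentiableAt_unitBall hzU).hasFDerivAt.sub
        (hasFDerivAt_id z)).fderiv
    rw [injective_iff_map_eq_zero]
    intro v hv
    have h3 : fderiv ℂ g z v = -v := by simp [h2, hv]
    have h4 := (fderiv ℂ g z).le_of_opNorm_le (h1.trans hhalf) v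
    rw [h3, norm_neg] at h4
    exact norm_eq_zero.1 (le_antisymm (by linarith) (norm_nonneg _))

end IsSchwarzMap

end SchwarzMap

/-! ### Subordination chains are Loewner chains -/

section Chain

variable {E : Type*} [NormedAddCommGroup E] [NormedSpace ℂ E]

/-- An evolution family: transition maps `φ s t`, `0 ≤ s ≤ t`, of Schwarz type with
`D(φ s t)(0) = e^(s-t) I`, composing as `φ s u = φ s t ∘ φ t u`. -/
structure IsEvolutionFamily (φ : ℝ → ℝ → E → E) : Prop where
  isSchwarzMap : ∀ s t, 0 ≤ s → s ≤ t → IsSchwarzMap (φ s t) (Real.exp (s - t))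
  comp : ∀ s t u, 0 ≤ s → s ≤ t → t ≤ u → ∀ z ∈ unitBall E, φ s u z = φ s t (φ t u z)

theorem IsNormalizedFamily.fderiv_zero_injective {f : ℝ → E → E} (hn : IsNormalizedFamily f)
    {t : ℝ} (ht : 0 ≤ t) : Function.Injective (fderiv ℂ (f t) 0) := by
  rw [(hn.2 t ht).2, injective_iff_map_eq_zero]
  intro v hv
  have : Real.exp (-t) ≠ 0 := (Real.exp_pos _).ne'
  simpa [-Complex.ofReal_exp, this] using hv

theorem IsSubordinationChain.exists_isSchwarzMap {f : ℝ → E → E} (hf : IsSubordinationChain f)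
    (hn : IsNormalizedFamily f) : ∃ φ : ℝ → ℝ → E → E, ∀ s t, 0 ≤ s → s ≤ t →
      IsSchwarzMap (φ s t) (Real.exp (s - t)) ∧ ∀ z ∈ unitBall E, f t z = f s (φ s t z) := by
  choose! φ hφd hφm hφ0 hφ using hf.2
  refine ⟨φ, fun s t hs hst => ⟨⟨hφd s t hs hst, hφm s t hs hst, hφ0 s t hs hst, ?_⟩,
    hφ s t hs hst⟩⟩
  have ht : 0 ≤ t := hs.trans hst
  have hφ' := ((hφd s t hs hst).differentiableAt_unitBall zero_mem_unitBall).hasFDerivAt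
  have hfs : HasFDerivAt (f s) (fderiv ℂ (f s) 0) (φ s t 0) := by
    rw [hφ0 s t hs hst]
    exact ((hf.1 s hs).differentiableAt_unitBall zero_mem_unitBall).hasFDerivAt
  have h1 : fderiv ℂ (f t) 0 = (fderiv ℂ (f s) 0).comp (fderiv ℂ (φ s t) 0) := by
    refine HasFDerivAt.fderiv ((hfs.comp 0 hφ').congr_of_eventuallyEq ?_)
    exact eventually_of_mem (unitBall_mem_nhds zero_mem_unitBall) (hφ s t hs hst)
  ext v
  apply hn.fderiv_zero_injective hs
  have h2 : fderiv ℂ (f s) 0 (fderiv ℂ (φ s t) 0 v) = fderiv ℂ (f t) 0 v := by rw [h1]; rfl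
  rw [h2, (hn.2 s hs).2, (hn.2 t ht).2]
  simp only [smul_apply, ContinuousLinearMap.id_apply, smul_smul]
  rw [← Complex.ofReal_mul, ← Real.exp_add]
  ring_nf

variable [FiniteDimensional ℂ E]

/-- The maps of a normalized subordination chain are injective with injective derivative: for a fine
subdivision of `[0, t]`, `f t` is a composition of transition maps close to the identity. -/
theorem IsSubordinationChain.injOn {f : ℝ → E → E} (hf : IsSubordinationChain f)
    (hn : IsNormalizedFamily f) {t : ℝ} (ht : 0 ≤ t) :
    InjOn (f t) (unitBall E) ∧ ∀ z ∈ unitBall E, Function.Injective (fderiv ℂ (f t) z) := by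
  obtain ⟨φ, hφ⟩ := hf.exists_isSchwarzMap hn
  have key : ∀ r, 0 ≤ r → r < 1 → InjOn (f t) (closedBall 0 r) ∧
      ∀ z ∈ closedBall (0 : E) r, Function.Injective (fderiv ℂ (f t) z) := by
    intro r hr0 hr
    have h1r : 0 < 1 - r := by linarith
    set δ := (1 - r) ^ 3 / 1536 with hδ
    have hδ0 : 0 < δ := by positivity
    have hsub : closedBall (0 : E) r ⊆ unitBall E := closedBall_subset_ball hr
    have step : ∀ n : ℕ, ∀ t, 0 ≤ t → t ≤ n * δ → InjOn (f t) (closedBall 0 r) ∧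
        ∀ z ∈ closedBall (0 : E) r, Function.Injective (fderiv ℂ (f t) z) := by
      intro n
      induction n with
      | zero =>
        intro t ht htn
        obtain rfl : t = 0 := le_antisymm (by simpa using htn) ht
        have hid : ∀ z ∈ closedBall (0 : E) r, f 0 z = z := fun z hz => hn.1 z (hsub hz)
        refine ⟨fun z hz w hw h => by rwa [hid z hz, hid w hw] at h, fun z hz => ?_⟩
        have : fderiv ℂ (f 0) z = ContinuousLinearMap.id ℂ E :=
          HasFDerivAt.fderiv ((hasFDerivAt_id z).congr_of_eventuallyEq
            (eventually_of_mem (unitBall_mem_nhds (hsub hz)) hn.1))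
        rw [this]
        exact Function.injective_id
      | succ n ih =>
        intro t ht htn
        rcases le_total t (n * δ) with h | h
        · exact ih t ht h
        set s := (n : ℝ) * δ with hs_def
        have hs : 0 ≤ s := by positivity
        obtain ⟨ihinj, ihder⟩ := ih s hs le_rfl
        obtain ⟨hS, hfs⟩ := hφ s t hs h
        have hts : t - s ≤ δ := by push_cast at htn; linarith
        obtain ⟨h1, h2⟩ := hS.injOn_closedBall (Real.exp_le_one_iff.2 (by linarith)) hr
          (by linarith [Real.add_one_le_exp (s - t)])
        have hmaps : MapsTo (φ s t) (closedBall 0 r) (closedBall 0 r) := fun z hz => by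
          rw [mem_closedBall_zero_iff] at hz ⊢
          exact (hS.norm_le (mem_unitBall.2 (by linarith))).trans hz
        refine ⟨fun z hz w hw hzw => ?_, fun z hz => ?_⟩
        · rw [hfs z (hsub hz), hfs w (hsub hw)] at hzw
          exact h1 hz hw (ihinj (hmaps hz) (hmaps hw) hzw)
        · have e : fderiv ℂ (f t) z
              = (fderiv ℂ (f s) (φ s t z)).comp (fderiv ℂ (φ s t) z) := by
            refine HasFDerivAt.fderiv (HasFDerivAt.congr_of_eventuallyEq ?_
              (eventually_of_mem (unitBall_mem_nhds (hsub hz)) hfs))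
            exact ((hf.1 s hs).differentiableAt_unitBall (hsub (hmaps hz))).hasFDerivAt.comp z
              (hS.differentiableOn.differentiableAt_unitBall (hsub hz)).hasFDerivAt
          rw [e]
          exact (ihder _ (hmaps hz)).comp (h2 z hz)
    obtain ⟨n, hn'⟩ := exists_nat_ge (t / δ)
    exact step n t ht ((div_le_iff₀ hδ0).1 hn')
  refine ⟨fun z hz w hw h => ?_, fun z hz => ?_⟩
  · have hm : max ‖z‖ ‖w‖ < 1 := max_lt (mem_unitBall.1 hz) (mem_unitBall.1 hw)
    exact (key _ (le_max_of_le_left (norm_nonneg _)) hm).1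
      (mem_closedBall_zero_iff.2 (le_max_left _ _)) (mem_closedBall_zero_iff.2 (le_max_right _ _)) h
  · exact (key _ (norm_nonneg z) (mem_unitBall.1 hz)).2 z (mem_closedBall_zero_iff.2 le_rfl)

theorem IsSubordinationChain.isLoewnerChain {f : ℝ → E → E} (hf : IsSubordinationChain f)
    (hn : IsNormalizedFamily f) : IsLoewnerChain f := by
  refine ⟨fun t ht => isBiholomorphicOnBall_of_injOn (hf.1 t ht) (hf.injOn hn ht).1
    (hf.injOn hn ht).2, ?_, hn⟩
  rintro s t hs hst _ ⟨z, hz, rfl⟩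
  obtain ⟨φ, -, hφm, -, hφ⟩ := hf.2 s t hs hst
  exact ⟨φ z, hφm hz, (hφ z hz).symm⟩

theorem IsSubordinationChain.exists_isEvolutionFamily {f : ℝ → E → E}
    (hf : IsSubordinationChain f) (hn : IsNormalizedFamily f) :
    ∃ φ : ℝ → ℝ → E → E, IsEvolutionFamily φ ∧
      ∀ s t, 0 ≤ s → s ≤ t → ∀ z ∈ unitBall E, f t z = f s (φ s t z) := by
  obtain ⟨φ, hφ⟩ := hf.exists_isSchwarzMap hn
  refine ⟨φ, ⟨fun s t hs hst => (hφ s t hs hst).1, fun s t u hs hst htu z hz => ?_⟩,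
    fun s t hs hst => (hφ s t hs hst).2⟩
  have ht := hs.trans hst
  have hw := (hφ t u ht htu).1.mapsTo hz
  refine (hf.injOn hn hs).1 ((hφ s u hs (hst.trans htu)).1.mapsTo hz)
    ((hφ s t hs hst).1.mapsTo hw) ?_
  rw [← (hφ s u hs (hst.trans htu)).2 z hz, ← (hφ s t hs hst).2 _ hw, ← (hφ t u ht htu).2 z hz]

end Chain

/-! ### The infinitesimal generators of an evolution family -/

section Generator

variable {E : Type*} [NormedAddCommGroup E] [NormedSpace ℂ E]

theorem norm_inv_smul_le {x : E} {K h : ℝ} (hK : 0 ≤ K) (hx : ‖x‖ ≤ K * |h|) :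
    ‖h⁻¹ • x‖ ≤ K := by
  rcases eq_or_ne h 0 with rfl | hh
  · simpa using hK
  · rw [norm_smul, norm_inv, Real.norm_eq_abs, inv_mul_le_iff₀ (abs_pos.2 hh)]
    linarith

variable [FiniteDimensional ℂ E]

namespace IsEvolutionFamily

variable {φ : ℝ → ℝ → E → E} {f : ℝ → E → E} {r s t : ℝ} {z : E}

theorem norm_sub_self_le (hφ : IsEvolutionFamily φ) (hs : 0 ≤ s) (hst : s ≤ t) (hr : r < 1)
    (hz : ‖z‖ ≤ r) : ‖φ s t z - z‖ ≤ 48 / (1 - r) ^ 2 * (t - s) := by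
  refine ((hφ.isSchwarzMap s t hs hst).norm_sub_self_le (Real.exp_le_one_iff.2 (by linarith))
    hr hz).trans ?_
  refine mul_le_mul_of_nonneg_left ?_ (by positivity)
  linarith [Real.add_one_le_exp (s - t)]

theorem norm_sub_le_of_eq (hφ : IsEvolutionFamily φ)
    (hf : ∀ t, 0 ≤ t → ∀ z ∈ unitBall E, f t z = φ 0 t z) (hs : 0 ≤ s) (ht : 0 ≤ t)
    (hr : r < 1) (hz : ‖z‖ ≤ r) : ‖f t z - f s z‖ ≤ 96 / (1 - r) ^ 3 * |t - s| := by
  have h1r : 0 < 1 - r := by linarith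
  wlog hst : s ≤ t generalizing s t
  · rw [norm_sub_rev, abs_sub_comm]
    exact this ht hs (le_of_not_ge hst)
  have hzU : z ∈ unitBall E := mem_unitBall.2 (by linarith)
  have hS := hφ.isSchwarzMap s t hs hst
  rw [hf t ht z hzU, hf s hs z hzU, hφ.comp 0 s t le_rfl hs hst z hzU, abs_of_nonneg (by linarith)]
  refine ((hφ.isSchwarzMap 0 s le_rfl hs).norm_sub_le hr ((hS.norm_le hzU).trans hz) hz).trans ?_
  calc 2 / (1 - r) * ‖φ s t z - z‖ ≤ 2 / (1 - r) * (48 / (1 - r) ^ 2 * (t - s)) := by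
        gcongr
        exact hφ.norm_sub_self_le hs hst hr hz
    _ = _ := by field_simp; ring

/-- Almost every time is a time of differentiability of `t ↦ f t z` simultaneously for all `z`: this
holds for a countable dense set of points by Rademacher's theorem, and the difference quotients are
equi-Lipschitz in `z`. -/
theorem ae_forall_differentiableAt (hφ : IsEvolutionFamily φ)
    (hf : ∀ t, 0 ≤ t → ∀ z ∈ unitBall E, f t z = φ 0 t z) :
    ∀ᵐ t ∂(volume.restrict (Ici (0 : ℝ))), 0 < t ∧ ∀ z ∈ unitBall E,
      DifferentiableAt ℝ (fun s => f s z) t := by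
  have := FiniteDimensional.proper ℂ E
  have hdf : ∀ t, 0 ≤ t → DifferentiableOn ℂ (f t) (unitBall E) := fun t ht =>
    (hφ.isSchwarzMap 0 t le_rfl ht).differentiableOn.congr (hf t ht)
  obtain ⟨D, hDc, hDd⟩ := TopologicalSpace.exists_countable_dense E
  have hpt : ∀ z ∈ D, ∀ᵐ t ∂(volume : Measure ℝ), z ∈ unitBall E → 0 < t →
      DifferentiableAt ℝ (fun s => f s z) t := by
    intro z _
    by_cases hz : z ∈ unitBall E
    · have hlip : LipschitzWith (Real.toNNReal (96 / (1 - ‖z‖) ^ 3)) fun t => f (max t 0) z := by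
        refine LipschitzWith.of_dist_le_mul fun t s => ?_
        have h1 : 0 < 1 - ‖z‖ := by linarith [mem_unitBall.1 hz]
        rw [dist_eq_norm, Real.coe_toNNReal _ (by positivity)]
        refine (hφ.norm_sub_le_of_eq hf (le_max_right _ _) (le_max_right _ _)
          (mem_unitBall.1 hz) le_rfl).trans ?_
        gcongr
        rw [Real.dist_eq]
        exact abs_max_sub_max_le_abs t s 0
      filter_upwards [hlip.ae_differentiableAt_real] with t ht _ ht0
      refine ht.congr_of_eventuallyEq ?_
      filter_upwards [lt_mem_nhds ht0] with s hs
      rw [max_eq_left hs.le]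
    · exact Eventually.of_forall fun t h => absurd h hz
  have hall := (ae_ball_iff hDc).2 hpt
  have hpos : ∀ᵐ t ∂(volume.restrict (Ici (0 : ℝ))), 0 < t := by
    rw [← Measure.restrict_congr_set Ioi_ae_eq_Ici]
    exact ae_restrict_mem measurableSet_Ioi
  filter_upwards [hpos, ae_restrict_of_ae hall] with t ht0 ht
  refine ⟨ht0, fun z hz => ?_⟩
  set r := (1 + ‖z‖) / 2 with hr
  have hz1 := mem_unitBall.1 hz
  have hr1 : r < 1 := by linarith
  set r' := (1 + r) / 2 with hr'
  set K := 96 / (1 - r') ^ 3 with hK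
  have h1r' : 0 < 1 - r' := by linarith
  have hrr' : 0 < r' - r := by linarith
  have hK0 : 0 < K := by positivity
  suffices h : ∃ a, Tendsto (slope (fun s => f s z) t) (𝓝[≠] t) (𝓝 a) by
    obtain ⟨a, ha⟩ := h
    exact (hasDerivAt_iff_tendsto_slope.2 ha).differentiableAt
  refine exists_tendsto_of_forall_dist_le fun ε hε => ?_
  set L := 2 * K / (r' - r) with hL
  have hL0 : 0 < L := by positivity
  obtain ⟨y, hyD, hy⟩ := hDd.exists_dist_lt z (ε := min (ε / L) ((1 - ‖z‖) / 2))
    (lt_min (by positivity) (by linarith))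
  have hyz : ‖z - y‖ ≤ ε / L := by
    rw [← dist_eq_norm]; exact hy.le.trans (min_le_left _ _)
  have hyr : ‖y‖ ≤ r := by
    have h1 : dist z y ≤ (1 - ‖z‖) / 2 := hy.le.trans (min_le_right _ _)
    have h2 := norm_le_insert z y
    rw [← dist_eq_norm] at h2
    linarith
  have hyU : y ∈ unitBall E := mem_unitBall.2 (by linarith)
  refine ⟨slope (fun s => f s y) t,
    ⟨_, hasDerivAt_iff_tendsto_slope.1 (ht y hyD hyU ht0).hasDerivAt⟩, ?_⟩
  filter_upwards [eventually_nhdsWithin_of_eventually_nhds (lt_mem_nhds ht0)] with s hs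
  have hsub : ball (0 : E) r' ⊆ unitBall E := ball_subset_ball (by linarith)
  have h1 := norm_sub_le_of_forall_ball_norm_le (f := fun z => f s z - f t z) (R := r')
    (C := K * |s - t|) (by linarith)
    (((hdf s hs.le).mono hsub).sub ((hdf t ht0.le).mono hsub))
    (fun w hw => hφ.norm_sub_le_of_eq hf ht0.le hs.le (by linarith) (mem_ball_zero_iff.1 hw).le)
    (mem_closedBall_zero_iff.2 hyr) (mem_closedBall_zero_iff.2 (by linarith : ‖z‖ ≤ r))
  have h2 : slope (fun s => f s z) t s - slope (fun s => f s y) t s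
      = (s - t)⁻¹ • ((f s z - f t z) - (f s y - f t y)) := by
    simp only [slope_def_module, smul_sub]
  rw [dist_eq_norm, h2]
  refine norm_inv_smul_le hε.le (h1.trans ?_)
  calc 2 * (K * |s - t|) / (r' - r) * ‖z - y‖ = L * |s - t| * ‖z - y‖ := by rw [hL]; ring
    _ ≤ L * |s - t| * (ε / L) := by gcongr
    _ = ε * |s - t| := by field_simp

/-- Where `t ↦ f t z` is differentiable, the transition maps `φ t (t + h)` have a generator, and the
Loewner equation holds: `f (t + h) z - f t z = f t (φ t (t + h) z) - f t z`. -/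
theorem exists_tendsto_of_differentiableAt (hφ : IsEvolutionFamily φ)
    (hfφ : ∀ s t, 0 ≤ s → s ≤ t → ∀ z ∈ unitBall E, f t z = f s (φ s t z)) (ht : 0 ≤ t)
    (hz : z ∈ unitBall E) (hf : DifferentiableAt ℂ (f t) z)
    (hinj : Function.Injective (fderiv ℂ (f t) z)) (hd : DifferentiableAt ℝ (fun s => f s z) t) :
    ∃ m, Tendsto (fun h : ℝ => h⁻¹ • (φ t (t + h) z - z)) (𝓝[>] 0) (𝓝 m) ∧
      HasDerivAt (fun s => f s z) (fderiv ℂ (f t) z m) t := by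
  have hz1 := mem_unitBall.1 hz
  set A := fderiv ℂ (f t) z with hA
  set K := 48 / (1 - ‖z‖) ^ 2 with hK
  have hφK : ∀ h > 0, ‖φ t (t + h) z - z‖ ≤ K * h := fun h hh => by
    simpa using hφ.norm_sub_self_le (t := t + h) ht (by linarith) hz1 le_rfl
  have hφz : Tendsto (fun h => φ t (t + h) z) (𝓝[>] (0 : ℝ)) (𝓝 z) := by
    rw [tendsto_iff_norm_sub_tendsto_zero]
    refine squeeze_zero' (Eventually.of_forall fun _ => norm_nonneg _)
      (eventually_of_mem self_mem_nhdsWithin hφK) ?_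
    have : Continuous fun h : ℝ => K * h := by fun_prop
    simpa using (this.tendsto 0).mono_left nhdsWithin_le_nhds
  have hF : Tendsto (fun h : ℝ => h⁻¹ • (f t (φ t (t + h) z) - f t z)) (𝓝[>] 0)
      (𝓝 (deriv (fun s => f s z) t)) := by
    refine hd.hasDerivAt.tendsto_slope_zero_right.congr' ?_
    filter_upwards [self_mem_nhdsWithin] with h hh
    rw [hfφ t (t + h) ht (by linarith [mem_Ioi.1 hh]) z hz]
  have hlo : Tendsto (fun h : ℝ => h⁻¹ • (f t (φ t (t + h) z) - f t z - A (φ t (t + h) z - z)))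
      (𝓝[>] 0) (𝓝 0) := by
    have h1 := (hasFDerivAt_iff_isLittleO.1 hf.hasFDerivAt).comp_tendsto hφz
    have h2 : (fun h => φ t (t + h) z - z) =O[𝓝[>] (0 : ℝ)] fun h => h := by
      refine Asymptotics.IsBigO.of_bound K ?_
      filter_upwards [self_mem_nhdsWithin] with h hh
      rw [Real.norm_of_nonneg (le_of_lt hh)]
      exact hφK h hh
    exact (h1.trans_isBigO h2).tendsto_inv_smul_nhds_zero
  have hAq : Tendsto (fun h : ℝ => A (h⁻¹ • (φ t (t + h) z - z))) (𝓝[>] 0)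
      (𝓝 (deriv (fun s => f s z) t)) := by
    have h1 := hF.sub hlo
    rw [sub_zero] at h1
    refine h1.congr fun h => ?_
    rw [← smul_sub, sub_sub_cancel, ContinuousLinearMap.map_smul_of_tower]
  let e : E ≃L[ℂ] E := (LinearEquiv.ofInjectiveEndo (A : E →ₗ[ℂ] E) hinj).toContinuousLinearEquiv
  have heA : ∀ x, e x = A x := fun x => rfl
  refine ⟨e.symm (deriv (fun s => f s z) t), ?_, ?_⟩
  · refine ((e.symm.continuous.tendsto _).comp hAq).congr fun h => ?_
    rw [Function.comp_apply, ← heA, e.symm_apply_apply]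
  · rw [← heA, e.apply_symm_apply]
    exact hd.hasDerivAt

theorem isHerglotzFunction_of_tendsto (hφ : IsEvolutionFamily φ) (ht : 0 ≤ t) {m : E → E}
    (hm : ∀ z ∈ unitBall E,
      Tendsto (fun h : ℝ => h⁻¹ • (φ t (t + h) z - z)) (𝓝[>] 0) (𝓝 (m z))) :
    IsHerglotzFunction m := by
  have := FiniteDimensional.complete ℂ E
  have hS : ∀ h > 0, IsSchwarzMap (φ t (t + h)) (Real.exp (-h)) := fun h hh => by
    have := hφ.isSchwarzMap t (t + h) ht (by linarith)
    rwa [sub_add_cancel_left] at this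
  have hlim : ∀ c ∈ unitBall E, DifferentiableAt ℂ m c ∧ ∀ v, Tendsto (fun h : ℝ =>
      fderiv ℂ (fun z => h⁻¹ • (φ t (t + h) z - z)) c v) (𝓝[>] 0) (𝓝 (fderiv ℂ m c v)) := by
    intro c hc
    have hc1 := mem_unitBall.1 hc
    have hsub : ball c ((1 - ‖c‖) / 2) ⊆ ball 0 ((1 + ‖c‖) / 2) :=
      ball_subset_ball' (by rw [dist_zero_right]; linarith)
    have hsub' : ball c ((1 - ‖c‖) / 2) ⊆ unitBall E :=
      hsub.trans (ball_subset_ball (by linarith))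
    refine differentiableAt_of_tendsto_of_norm_le (R := (1 - ‖c‖) / 2)
      (C := 48 / (1 - (1 + ‖c‖) / 2) ^ 2) (by linarith) ?_ fun z hz => hm z (hsub' hz)
    filter_upwards [self_mem_nhdsWithin] with h hh
    refine ⟨((((hS h hh).differentiableOn.mono hsub').sub differentiableOn_id).const_smul
      (h⁻¹ : ℝ)), fun z hz => norm_inv_smul_le (by positivity) ?_⟩
    have h1 := hφ.norm_sub_self_le (t := t + h) ht (by linarith [mem_Ioi.1 hh])
      (by linarith : (1 + ‖c‖) / 2 < 1) (mem_ball_zero_iff.1 (hsub hz)).le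
    rw [abs_of_pos (mem_Ioi.1 hh)]
    rwa [add_sub_cancel_left] at h1
  have hmd : DifferentiableOn ℂ m (unitBall E) := fun c hc =>
    (hlim c hc).1.differentiableWithinAt
  have hm0 : m 0 = 0 := by
    refine tendsto_nhds_unique (hm 0 zero_mem_unitBall) (tendsto_const_nhds.congr' ?_)
    filter_upwards [self_mem_nhdsWithin] with h hh
    rw [(hS h hh).map_zero, sub_zero, smul_zero]
  have hmD : fderiv ℂ m 0 = -ContinuousLinearMap.id ℂ E := by
    ext v
    refine tendsto_nhds_unique ((hlim 0 zero_mem_unitBall).2 v) ?_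
    have hexp : Tendsto (fun h : ℝ => h⁻¹ * (Real.exp (-h) - 1)) (𝓝[>] 0) (𝓝 (-1)) := by
      have h1 : HasDerivAt (fun h : ℝ => Real.exp (-h)) (-1) 0 := by
        simpa using (hasDerivAt_neg (0 : ℝ)).exp
      simpa using h1.tendsto_slope_zero_right
    have h2 := hexp.smul_const v
    rw [neg_one_smul] at h2
    refine h2.congr' ?_
    filter_upwards [self_mem_nhdsWithin] with h hh
    have h3 := (((hS h hh).differentiableOn.differentiableAt_unitBall
      zero_mem_unitBall).hasFDerivAt.sub (hasFDerivAt_id (0 : E))).const_smul (h⁻¹ : ℝ)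
    rw [(hS h hh).fderiv_zero] at h3
    have h4 : fderiv ℂ (fun z => h⁻¹ • (φ t (t + h) z - z)) 0 = _ := h3.fderiv
    rw [h4]
    simp only [smul_apply, sub_apply, ContinuousLinearMap.id_apply, mul_smul, sub_smul, one_smul,
      Complex.coe_smul]
  refine ⟨hmd, hm0, hmD, fun z hz hz0 l hlz hl =>
    re_neg_of_re_nonpos hmd hm0 hmD (fun z hz hz0 l hlz hl => ?_) hz hz0 hlz hl⟩
  have h1 := (Complex.continuous_re.comp l.continuous).tendsto (m z)
  refine le_of_tendsto (h1.comp (hm z hz)) ?_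
  filter_upwards [self_mem_nhdsWithin] with h hh
  simp only [Function.comp_apply]
  rw [ContinuousLinearMap.map_smul_of_tower, Complex.real_smul, Complex.re_ofReal_mul]
  exact mul_nonpos_of_nonneg_of_nonpos (inv_nonneg.2 (le_of_lt hh))
    ((hS h hh).re_sub_nonpos hz hlz hl)

theorem continuousOn_shift (hφ : IsEvolutionFamily φ) {a : ℝ} (ha : 0 ≤ a) (hz : z ∈ unitBall E) :
    ContinuousOn (fun t => φ t (t + a) z) (Ici 0) := by
  have hz1 := mem_unitBall.1 hz
  have h1z : 0 < 1 - ‖z‖ := by linarith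
  set K := 96 / (1 - ‖z‖) ^ 3 + 48 / (1 - ‖z‖) ^ 2 with hK
  have hK0 : 0 ≤ K := by positivity
  have key : ∀ s t, 0 ≤ s → s ≤ t → ‖φ t (t + a) z - φ s (s + a) z‖ ≤ K * (t - s) := by
    intro s t hs hst
    have e1 := hφ.comp s (s + a) (t + a) hs (by linarith) (by linarith) z hz
    have e2 := hφ.comp s t (t + a) hs (by linarith) (by linarith) z hz
    have hS1 := hφ.isSchwarzMap s (s + a) hs (by linarith)
    have hS2 := hφ.isSchwarzMap (s + a) (t + a) (by linarith) (by linarith)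
    have hS3 := hφ.isSchwarzMap t (t + a) (by linarith) (by linarith)
    have h1 := hS1.norm_sub_le hz1 (hS2.norm_le hz) le_rfl
    have h2 := hφ.norm_sub_self_le (s := s + a) (t := t + a) (by linarith) (by linarith) hz1
      (z := z) le_rfl
    have h3 := hφ.norm_sub_self_le hs hst hz1 (hS3.norm_le hz)
    rw [← e1] at h1
    rw [← e2, norm_sub_rev] at h3
    rw [add_sub_add_right_eq_sub] at h2
    calc ‖φ t (t + a) z - φ s (s + a) z‖
        = ‖(φ t (t + a) z - φ s (t + a) z) + (φ s (t + a) z - φ s (s + a) z)‖ := by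
          congr 1; abel
      _ ≤ 48 / (1 - ‖z‖) ^ 2 * (t - s) + 2 / (1 - ‖z‖) * (48 / (1 - ‖z‖) ^ 2 * (t - s)) :=
          (norm_add_le _ _).trans (add_le_add h3 (h1.trans (by gcongr)))
      _ = K * (t - s) := by rw [hK]; field_simp; ring
  refine (LipschitzOnWith.of_dist_le_mul (K := Real.toNNReal K) fun t ht s hs => ?_).continuousOn
  rw [Real.coe_toNNReal _ hK0]
  rcases le_total s t with h | h
  · rw [dist_eq_norm, Real.dist_eq, abs_of_nonneg (by linarith)]
    exact key s t hs h
  · rw [dist_comm, dist_comm t, dist_eq_norm, Real.dist_eq, abs_of_nonneg (by linarith)]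
    exact key t s ht h

end IsEvolutionFamily

end Generator

section SubordinationPDE

theorem isHerglotzFunction_neg {E : Type*} [NormedAddCommGroup E] [NormedSpace ℂ E] :
    IsHerglotzFunction fun z : E => -z := by
  refine ⟨differentiableOn_id.neg, neg_zero, ?_, fun z _ hz l hlz _ => ?_⟩
  · exact (hasFDerivAt_id (0 : E)).neg.fderiv
  · rw [map_neg, hlz]
    simpa using hz

variable {E : Type*} [NormedAddCommGroup E] [NormedSpace ℂ E] [FiniteDimensional ℂ E]

/-- At almost every time all generators exist and the Loewner equation holds with them. -/
theorem IsEvolutionFamily.ae_exists_generator {φ : ℝ → ℝ → E → E} {f : ℝ → E → E}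
    (hφ : IsEvolutionFamily φ) (hf : IsSubordinationChain f) (hn : IsNormalizedFamily f)
    (hfφ : ∀ s t, 0 ≤ s → s ≤ t → ∀ z ∈ unitBall E, f t z = f s (φ s t z)) :
    ∀ᵐ t ∂(volume.restrict (Ici (0 : ℝ))), ∀ z ∈ unitBall E,
      ∃ m, Tendsto (fun h : ℝ => h⁻¹ • (φ t (t + h) z - z)) (𝓝[>] 0) (𝓝 m) ∧
        HasDerivAt (fun s => f s z) (fderiv ℂ (f t) z m) t := by
  have hf0 : ∀ t, 0 ≤ t → ∀ z ∈ unitBall E, f t z = φ 0 t z := fun t ht z hz => by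
    rw [hfφ 0 t le_rfl ht z hz, hn.1 _ ((hφ.isSchwarzMap 0 t le_rfl ht).mapsTo hz)]
  filter_upwards [hφ.ae_forall_differentiableAt hf0] with t ⟨ht, htd⟩ z hz
  exact hφ.exists_tendsto_of_differentiableAt hfφ ht.le hz
    ((hf.1 t ht.le).differentiableAt_unitBall hz) ((hf.injOn hn ht.le).2 z hz) (htd z hz)

open Classical in
theorem IsSubordinationChain.exists_isHerglotzVectorField {f : ℝ → E → E}
    (hf : IsSubordinationChain f) (hn : IsNormalizedFamily f) :
    ∃ M : E → ℝ → E, IsHerglotzVectorField M ∧ SolvesLoewnerPDE f M := by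
  obtain ⟨φ, hφ, hfφ⟩ := hf.exists_isEvolutionFamily hn
  have hae := hφ.ae_exists_generator hf hn hfφ
  let good : ℝ → Prop := fun t => ∀ z ∈ unitBall E,
    ∃ m, Tendsto (fun h : ℝ => h⁻¹ • (φ t (t + h) z - z)) (𝓝[>] 0) (𝓝 m)
  let M : E → ℝ → E := fun z t =>
    if good t then limUnder (𝓝[>] 0) (fun h : ℝ => h⁻¹ • (φ t (t + h) z - z)) else -z
  have hM : ∀ t, good t → ∀ z ∈ unitBall E,
      Tendsto (fun h : ℝ => h⁻¹ • (φ t (t + h) z - z)) (𝓝[>] 0) (𝓝 (M z t)) := by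
    intro t ht z hz
    simp only [M, if_pos ht]
    exact tendsto_nhds_limUnder (ht z hz)
  refine ⟨M, ⟨fun t ht => ?_, fun z hz => ?_⟩, hf.1, hn.1, ?_⟩
  · by_cases hg : good t
    · exact hφ.isHerglotzFunction_of_tendsto ht (hM t hg)
    · simp only [M, if_neg hg]
      exact isHerglotzFunction_neg
  · have := FiniteDimensional.proper ℂ E
    have hseq : Tendsto (fun n : ℕ => ((n : ℝ) + 1)⁻¹) atTop (𝓝[>] 0) := by
      refine tendsto_nhdsWithin_iff.2 ⟨?_, Eventually.of_forall fun n => mem_Ioi.2 (by positivity)⟩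
      simpa using tendsto_one_div_add_atTop_nhds_zero_nat (𝕜 := ℝ)
    refine aestronglyMeasurable_of_tendsto_ae atTop
      (f := fun (n : ℕ) t => (((n : ℝ) + 1)⁻¹)⁻¹ • (φ t (t + ((n : ℝ) + 1)⁻¹) z - z))
      (fun n => ?_) ?_
    · refine AEStronglyMeasurable.const_smul (ContinuousOn.aestronglyMeasurable ?_
        measurableSet_Ici) _
      exact (hφ.continuousOn_shift (by positivity) hz).sub continuousOn_const
    · filter_upwards [hae] with t ht
      exact (hM t (fun z hz => (ht z hz).imp fun m hm => hm.1) z hz).comp hseq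
  · filter_upwards [hae] with t ht z hz
    obtain ⟨m, hm, hd⟩ := ht z hz
    have e : m = M z t := tendsto_nhds_unique hm
      (hM t (fun z hz => (ht z hz).imp fun m hm => hm.1) z hz)
    rwa [← e]

end SubordinationPDE

/-! ### Comparison lemmas for quantities with small increments -/

section Comparison

theorem le_of_forall_le_add_sq {N : ℝ → ℝ} {s t C : ℝ} (hst : s ≤ t)
    (h : ∀ a b, s ≤ a → a ≤ b → b ≤ t → N a ≤ N b + C * (b - a) ^ 2) : N s ≤ N t := by
  have key : ∀ n : ℕ, N s ≤ N t + C * (t - s) ^ 2 * (1 / ((n : ℝ) + 1)) := by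
    intro n
    have hn : (0 : ℝ) < n + 1 := by positivity
    set d := (t - s) / (n + 1) with hd
    have hd0 : 0 ≤ d := div_nonneg (by linarith) hn.le
    have hnd : (n + 1) * d = t - s := by rw [hd]; field_simp
    have step : ∀ i : ℕ, i ≤ n + 1 → N s ≤ N (s + i * d) + i * (C * d ^ 2) := by
      intro i
      induction i with
      | zero => intro _; simp
      | succ i ih =>
        intro hi
        have hi' : ((i + 1 : ℕ) : ℝ) * d ≤ (n + 1) * d := by
          gcongr
          exact_mod_cast hi
        have hid : 0 ≤ i * d := by positivity
        have h1 := h (s + i * d) (s + (i + 1 : ℕ) * d) (by linarith)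
          (by push_cast; linarith) (by linarith)
        have h2 := ih (by omega)
        have e : s + ((i + 1 : ℕ) : ℝ) * d - (s + i * d) = d := by push_cast; ring
        rw [e] at h1
        push_cast at h1 ⊢
        linarith
    have h1 := step (n + 1) le_rfl
    push_cast at h1
    rw [hnd, add_sub_cancel] at h1
    refine h1.trans (le_of_eq ?_)
    rw [hd]
    field_simp
  have hlim : Tendsto (fun n : ℕ => N t + C * (t - s) ^ 2 * (1 / ((n : ℝ) + 1))) atTop
      (𝓝 (N t + C * (t - s) ^ 2 * 0)) :=
    tendsto_const_nhds.add (tendsto_const_nhds.mul tendsto_one_div_add_atTop_nhds_zero_nat)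
  rw [mul_zero, add_zero] at hlim
  exact ge_of_tendsto' hlim key

/-- A backward Gronwall lemma in terms of increments. -/
theorem eq_zero_of_forall_le_add_sq {N : ℝ → ℝ} {s t L C : ℝ} (hst : s ≤ t)
    (hC : 0 ≤ C) (hN : ∀ a, 0 ≤ N a)
    (h : ∀ a b, s ≤ a → a ≤ b → b ≤ t → N a ≤ (1 + L * (b - a)) * N b + C * (b - a) ^ 2)
    (ht : N t = 0) (hL : 0 ≤ L) : N s = 0 := by
  have h1 := le_of_forall_le_add_sq (N := fun a => Real.exp (L * a) * N a)
    (C := Real.exp (L * t) * C) hst fun a b ha hab hb => by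
      have e1 : Real.exp (L * a) * (1 + L * (b - a)) ≤ Real.exp (L * b) := by
        have : Real.exp (L * b) = Real.exp (L * a) * Real.exp (L * (b - a)) := by
          rw [← Real.exp_add]; ring_nf
        rw [this]
        gcongr
        linarith [Real.add_one_le_exp (L * (b - a))]
      have e2 : Real.exp (L * a) ≤ Real.exp (L * t) := by
        gcongr
        linarith
      calc Real.exp (L * a) * N a
          ≤ Real.exp (L * a) * ((1 + L * (b - a)) * N b + C * (b - a) ^ 2) := by
            gcongr
            exact h a b ha hab hb
        _ = (Real.exp (L * a) * (1 + L * (b - a))) * N b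
            + Real.exp (L * a) * (C * (b - a) ^ 2) := by ring
        _ ≤ Real.exp (L * b) * N b + Real.exp (L * t) * (C * (b - a) ^ 2) := by
            gcongr
            exact hN b
        _ = _ := by ring
  simp only [ht, mul_zero] at h1
  exact le_antisymm (nonpos_of_mul_nonpos_right h1 (Real.exp_pos _)) (hN s)

end Comparison

/-! ### Trajectories of a Herglotz vector field -/

section Trajectory

variable {E : Type*} [NormedAddCommGroup E] [NormedSpace ℂ E] [FiniteDimensional ℂ E]

theorem IsHerglotzFunction.norm_le {h : E → E} (hh : IsHerglotzFunction h) {r : ℝ} (hr : r < 1)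
    {z : E} (hz : ‖z‖ ≤ r) : ‖h z‖ ≤ 48 / (1 - r) ^ 2 := by
  have := norm_le_of_re_nonpos hh.1 hh.2.1 zero_le_one
    (by rw [hh.2.2.1, Complex.ofReal_one, one_smul])
    (fun z hz hz0 l hlz hl => (hh.2.2.2 z hz hz0 l hlz hl).le) hr hz
  rwa [mul_one] at this

theorem IsHerglotzFunction.norm_sub_le {h : E → E} (hh : IsHerglotzFunction h) {r : ℝ} (hr : r < 1)
    {z w : E} (hz : ‖z‖ ≤ r) (hw : ‖w‖ ≤ r) : ‖h z - h w‖ ≤ 768 / (1 - r) ^ 3 * ‖z - w‖ := by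
  have h1r : 0 < 1 - r := by linarith
  refine (norm_sub_le_of_forall_ball_norm_le (R := (1 + r) / 2) (by linarith)
    (hh.1.mono (ball_subset_ball (by linarith)))
    (fun x hx => hh.norm_le (by linarith : (1 + r) / 2 < 1) (mem_ball_zero_iff.1 hx).le)
    (mem_closedBall_zero_iff.2 hw) (mem_closedBall_zero_iff.2 hz)).trans (le_of_eq ?_)
  have e1 : 1 - (1 + r) / 2 = (1 - r) / 2 := by ring
  have e2 : (1 + r) / 2 - r = (1 - r) / 2 := by ring
  rw [e1, e2]
  field_simp
  norm_num
  ring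

variable {M : E → ℝ → E} {s t : ℝ} {w : ℝ → E} {z : E}

omit [FiniteDimensional ℂ E] in
/-- A Herglotz vector field is a Carathéodory function, so it may be evaluated along continuous
curves: replace the curve by step functions and pass to the limit. -/
theorem IsHerglotzVectorField.aestronglyMeasurable_comp (hM : IsHerglotzVectorField M)
    (hs : 0 ≤ s) (hst : s ≤ t) (hw : ContinuousOn w (Icc s t))
    (hwU : MapsTo w (Icc s t) (unitBall E)) :
    AEStronglyMeasurable (fun σ => M (w σ) σ) (volume.restrict (Icc s t)) := by
  set W : ℝ → E := IccExtend hst ((Icc s t).domRestrict w) with hW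
  have hWc : Continuous W := (continuousOn_iff_continuous_domRestrict.1 hw).Icc_extend'
  have hWU : ∀ σ, W σ ∈ unitBall E := fun σ => hwU (projIcc s t hst σ).2
  have hWw : ∀ σ ∈ Icc s t, W σ = w σ := fun σ hσ => by
    rw [hW, IccExtend_of_mem hst _ hσ]; rfl
  suffices h : AEStronglyMeasurable (fun σ => M (W σ) σ) (volume.restrict (Ici (0 : ℝ))) by
    refine (h.mono_measure (Measure.restrict_mono (fun x hx => hs.trans hx.1) le_rfl)).congr ?_
    filter_upwards [ae_restrict_mem measurableSet_Icc] with σ hσ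
    rw [hWw σ hσ]
  refine aestronglyMeasurable_of_tendsto_ae atTop
    (f := fun (n : ℕ) σ => M (W (⌊((n : ℝ) + 1) * σ⌋ / ((n : ℝ) + 1))) σ) (fun n => ?_) ?_
  · have hmeas : Measurable fun σ : ℝ => ⌊((n : ℝ) + 1) * σ⌋ :=
      Int.measurable_floor.comp (measurable_const_mul _)
    have hcover : (⋃ k : ℤ, (fun σ : ℝ => ⌊((n : ℝ) + 1) * σ⌋) ⁻¹' {k}) = univ := by
      ext σ; simp
    rw [← Measure.restrict_univ (μ := volume.restrict (Ici (0 : ℝ))), ← hcover,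
      aestronglyMeasurable_iUnion_iff]
    intro k
    refine ((hM.2 (W (k / ((n : ℝ) + 1))) (hWU _)).mono_measure Measure.restrict_le_self).congr ?_
    filter_upwards [ae_restrict_mem (hmeas (measurableSet_singleton k))] with σ hσ
    rw [mem_preimage, mem_singleton_iff] at hσ
    rw [hσ]
  · filter_upwards [ae_restrict_mem measurableSet_Ici] with σ hσ
    have hfl : Tendsto (fun n : ℕ => (⌊((n : ℝ) + 1) * σ⌋ : ℝ) / ((n : ℝ) + 1)) atTop (𝓝 σ) := by
      have h1 := tendsto_one_div_add_atTop_nhds_zero_nat (𝕜 := ℝ)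
      rw [tendsto_iff_dist_tendsto_zero]
      refine squeeze_zero (fun _ => dist_nonneg) (fun n => ?_) h1
      have hn : (0 : ℝ) < n + 1 := by positivity
      have e : (⌊((n : ℝ) + 1) * σ⌋ : ℝ) / ((n : ℝ) + 1) - σ
          = (⌊((n : ℝ) + 1) * σ⌋ - ((n : ℝ) + 1) * σ) / ((n : ℝ) + 1) := by field_simp
      rw [Real.dist_eq, e, abs_div, abs_of_pos hn]
      gcongr
      rw [abs_le]
      constructor <;> linarith [Int.floor_le (((n : ℝ) + 1) * σ),
        Int.lt_floor_add_one (((n : ℝ) + 1) * σ)]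
    have hcont : ContinuousAt (fun z => M z σ) (W σ) :=
      ((hM.1 σ hσ).1.differentiableAt_unitBall (hWU σ)).continuousAt
    exact hcont.tendsto.comp ((hWc.tendsto σ).comp hfl)

theorem IsHerglotzVectorField.intervalIntegrable_comp (hM : IsHerglotzVectorField M)
    (hs : 0 ≤ s) (hw : ContinuousOn w (Icc s t)) {r : ℝ} (hr : r < 1)
    (hwr : ∀ τ ∈ Icc s t, ‖w τ‖ ≤ r) {a b : ℝ} (ha : s ≤ a) (hab : a ≤ b) (hb : b ≤ t) :
    IntervalIntegrable (fun σ => M (w σ) σ) volume a b := by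
  rw [intervalIntegrable_iff_integrableOn_Ioc_of_le hab]
  have hst : s ≤ t := ha.trans (hab.trans hb)
  have hsub : Ioc a b ⊆ Icc s t := fun x hx => ⟨ha.trans hx.1.le, hx.2.trans hb⟩
  have hU : MapsTo w (Icc s t) (unitBall E) := fun τ hτ =>
    mem_unitBall.2 ((hwr τ hτ).trans_lt hr)
  refine Integrable.of_bound
    ((hM.aestronglyMeasurable_comp hs hst hw hU).mono_set hsub)
    (48 / (1 - r) ^ 2) ?_
  filter_upwards [ae_restrict_mem measurableSet_Ioc] with σ hσ
  exact (hM.1 σ (hs.trans (hsub hσ).1)).norm_le hr (hwr σ (hsub hσ))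

/-- `w` solves the backward equation `w' = -M(w, τ)`, `w t = z`, on `[s, t]`, in integrated form.
Along such trajectories solutions of the Loewner equation are constant. -/
structure IsTrajectory (M : E → ℝ → E) (s t : ℝ) (z : E) (w : ℝ → E) : Prop where
  continuousOn : ContinuousOn w (Icc s t)
  mapsTo : MapsTo w (Icc s t) (unitBall E)
  eq : ∀ τ ∈ Icc s t, w τ = z + ∫ σ in τ..t, M (w σ) σ

namespace IsTrajectory

variable {a b r : ℝ}

omit [FiniteDimensional ℂ E] in
theorem eq_right (h : IsTrajectory M s t z w) (hst : s ≤ t) : w t = z := by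
  have := h.eq t ⟨hst, le_rfl⟩
  simpa using this

omit [FiniteDimensional ℂ E] in
theorem exists_norm_le (h : IsTrajectory M s t z w) (hst : s ≤ t) :
    ∃ r < 1, ∀ τ ∈ Icc s t, ‖w τ‖ ≤ r := by
  obtain ⟨x, hx, hmax⟩ := isCompact_Icc.exists_isMaxOn (nonempty_Icc.2 hst) h.continuousOn.norm
  exact ⟨‖w x‖, mem_unitBall.1 (h.mapsTo hx), hmax⟩

theorem sub_eq_integral (h : IsTrajectory M s t z w) (hM : IsHerglotzVectorField M) (hs : 0 ≤ s)
    (hsa : s ≤ a) (hab : a ≤ b) (hbt : b ≤ t) : w a = w b + ∫ σ in a..b, M (w σ) σ := by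
  obtain ⟨r, hr, hwr⟩ := h.exists_norm_le (hsa.trans (hab.trans hbt))
  rw [h.eq a ⟨hsa, hab.trans hbt⟩, h.eq b ⟨hsa.trans hab, hbt⟩, add_assoc,
    add_comm (∫ σ in b..t, _), intervalIntegral.integral_add_adjacent_intervals]
  · exact hM.intervalIntegrable_comp hs h.continuousOn hr hwr hsa hab hbt
  · exact hM.intervalIntegrable_comp hs h.continuousOn hr hwr (hsa.trans hab) hbt le_rfl

theorem norm_sub_le (h : IsTrajectory M s t z w) (hM : IsHerglotzVectorField M) (hs : 0 ≤ s)
    (hr : r < 1) (hwr : ∀ τ ∈ Icc s t, ‖w τ‖ ≤ r) (hsa : s ≤ a) (hab : a ≤ b) (hbt : b ≤ t) :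
    ‖w a - w b‖ ≤ 48 / (1 - r) ^ 2 * (b - a) := by
  rw [h.sub_eq_integral hM hs hsa hab hbt, add_sub_cancel_left]
  refine (intervalIntegral.norm_integral_le_of_norm_le_const fun σ hσ => ?_).trans
    (le_of_eq (by rw [abs_of_nonneg (by linarith : 0 ≤ b - a)]))
  rw [uIoc_of_le hab] at hσ
  exact (hM.1 σ (by linarith [hσ.1])).norm_le hr (hwr σ ⟨by linarith [hσ.1], by linarith [hσ.2]⟩)

theorem norm_sub_sub_le (h : IsTrajectory M s t z w) (hM : IsHerglotzVectorField M) (hs : 0 ≤ s)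
    (hr : r < 1) (hwr : ∀ τ ∈ Icc s t, ‖w τ‖ ≤ r) (hsa : s ≤ a) (hab : a ≤ b) (hbt : b ≤ t)
    {c : ℝ} (hc : c ∈ Icc a b) :
    ‖w a - w b - ∫ σ in a..b, M (w c) σ‖
      ≤ 768 / (1 - r) ^ 3 * (48 / (1 - r) ^ 2) * (b - a) ^ 2 := by
  have hcI : c ∈ Icc s t := ⟨hsa.trans hc.1, hc.2.trans hbt⟩
  have hi1 := hM.intervalIntegrable_comp hs h.continuousOn hr hwr hsa hab hbt
  have hi2 := hM.intervalIntegrable_comp hs (w := fun _ => w c) (continuousOn_const) hr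
    (fun _ _ => hwr c hcI) hsa hab hbt
  have h1r : 0 < 1 - r := by linarith
  rw [h.sub_eq_integral hM hs hsa hab hbt, add_sub_cancel_left,
    ← intervalIntegral.integral_sub hi1 hi2]
  refine (intervalIntegral.norm_integral_le_of_norm_le_const
    (C := 768 / (1 - r) ^ 3 * (48 / (1 - r) ^ 2 * (b - a))) fun σ hσ => ?_).trans
    (le_of_eq (by rw [abs_of_nonneg (by linarith : 0 ≤ b - a)]; ring))
  rw [uIoc_of_le hab] at hσ
  have hσI : σ ∈ Icc s t := ⟨by linarith [hσ.1], by linarith [hσ.2]⟩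
  refine ((hM.1 σ (by linarith [hσI.1])).norm_sub_le hr (hwr σ hσI) (hwr c hcI)).trans ?_
  gcongr
  rcases le_total σ c with hσc | hσc
  · refine (h.norm_sub_le hM hs hr hwr hσI.1 hσc hcI.2).trans ?_
    gcongr
    · exact hc.2
    · exact hσ.1.le
  · rw [norm_sub_rev]
    refine (h.norm_sub_le hM hs hr hwr hcI.1 hσc hσI.2).trans ?_
    gcongr
    · exact hσ.2
    · exact hc.1

/-- Dissipativity: backwards in time, trajectories move towards the origin. -/
theorem norm_le (h : IsTrajectory M s t z w) (hM : IsHerglotzVectorField M) (hs : 0 ≤ s)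
    {τ : ℝ} (hτ : τ ∈ Icc s t) : ‖w τ‖ ≤ ‖z‖ := by
  have := FiniteDimensional.complete ℂ E
  obtain ⟨r, hr, hwr⟩ := h.exists_norm_le (hτ.1.trans hτ.2)
  have h1r : 0 < 1 - r := by linarith
  rw [← h.eq_right (hτ.1.trans hτ.2)]
  refine le_of_forall_le_add_sq (N := fun τ => ‖w τ‖) hτ.2
    (C := 768 / (1 - r) ^ 3 * (48 / (1 - r) ^ 2)) fun a b ha hab hb => ?_
  have hsa : s ≤ a := hτ.1.trans ha
  rcases eq_or_ne (w a) 0 with h0 | h0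
  · simp only [h0, norm_zero]
    positivity
  obtain ⟨l, hl1, hl⟩ := exists_dual_vector ℂ (w a) (norm_ne_zero_iff.2 h0)
  have hle : ∀ x, (l x).re ≤ ‖x‖ := fun x =>
    (Complex.re_le_norm _).trans (by simpa [hl1] using l.le_opNorm x)
  have hi : IntervalIntegrable (fun σ => M (w a) σ) volume a b :=
    hM.intervalIntegrable_comp hs (w := fun _ => w a) continuousOn_const hr
      (fun _ _ => hwr a ⟨hsa, hab.trans hb⟩) hsa hab hb
  have hneg : (l (∫ σ in a..b, M (w a) σ)).re ≤ 0 := by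
    have e : (l (∫ σ in a..b, M (w a) σ)).re = ∫ σ in a..b, (l (M (w a) σ)).re :=
      ((Complex.reCLM.comp (l.restrictScalars ℝ)).intervalIntegral_comp_comm hi).symm
    rw [e, ← neg_nonneg, ← intervalIntegral.integral_neg]
    refine intervalIntegral.integral_nonneg hab fun σ hσ => ?_
    have h1 := (hM.1 σ (by linarith [hσ.1])).2.2.2 (w a) (h.mapsTo ⟨hsa, hab.trans hb⟩) h0 l hl hl1
    linarith
  have e : l (w a) = l (w b) + l (∫ σ in a..b, M (w a) σ)
      + l (w a - w b - ∫ σ in a..b, M (w a) σ) := by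
    simp only [map_sub]; ring
  have hn : ‖w a‖ = (l (w a)).re := by rw [hl]; simp
  rw [hn, e, Complex.add_re, Complex.add_re]
  have h1 := (hle (w a - w b - ∫ σ in a..b, M (w a) σ)).trans
    (h.norm_sub_sub_le hM hs hr hwr hsa hab hb ⟨le_rfl, hab⟩)
  linarith [hle (w b)]

theorem unique (h : IsTrajectory M s t z w) {w' : ℝ → E} (h' : IsTrajectory M s t z w')
    (hM : IsHerglotzVectorField M) (hs : 0 ≤ s) {τ : ℝ} (hτ : τ ∈ Icc s t) : w τ = w' τ := by
  have hst := hτ.1.trans hτ.2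
  obtain ⟨r₁, hr₁, hwr₁⟩ := h.exists_norm_le hst
  obtain ⟨r₂, hr₂, hwr₂⟩ := h'.exists_norm_le hst
  set r := max r₁ r₂
  have hr : r < 1 := max_lt hr₁ hr₂
  have hwr : ∀ τ ∈ Icc s t, ‖w τ‖ ≤ r := fun τ hτ => (hwr₁ τ hτ).trans (le_max_left _ _)
  have hwr' : ∀ τ ∈ Icc s t, ‖w' τ‖ ≤ r := fun τ hτ => (hwr₂ τ hτ).trans (le_max_right _ _)
  have h1r : 0 < 1 - r := by linarith
  set L := 768 / (1 - r) ^ 3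
  set K := 48 / (1 - r) ^ 2
  have hL : 0 ≤ L := by positivity
  have hK : 0 ≤ K := by positivity
  have key := eq_zero_of_forall_le_add_sq (N := fun τ => ‖w τ - w' τ‖) hτ.2 (L := L)
    (C := L * (2 * K)) (by positivity) (fun _ => norm_nonneg _) (fun a b ha hab hb => ?_)
    (by rw [h.eq_right hst, h'.eq_right hst, sub_self, norm_zero]) hL
  · exact sub_eq_zero.1 (norm_eq_zero.1 key)
  have hsa : s ≤ a := hτ.1.trans ha
  have hi := hM.intervalIntegrable_comp hs h.continuousOn hr hwr hsa hab hb
  have hi' := hM.intervalIntegrable_comp hs h'.continuousOn hr hwr' hsa hab hb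
  have e : w a - w' a = (w b - w' b) + ∫ σ in a..b, (M (w σ) σ - M (w' σ) σ) := by
    rw [intervalIntegral.integral_sub hi hi', h.sub_eq_integral hM hs hsa hab hb,
      h'.sub_eq_integral hM hs hsa hab hb]
    abel
  have hI : ‖∫ σ in a..b, (M (w σ) σ - M (w' σ) σ)‖
      ≤ L * (‖w b - w' b‖ + 2 * K * (b - a)) * |b - a| := by
    refine intervalIntegral.norm_integral_le_of_norm_le_const fun σ hσ => ?_
    rw [uIoc_of_le hab] at hσ
    have hσI : σ ∈ Icc s t := ⟨by linarith [hσ.1], by linarith [hσ.2]⟩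
    refine ((hM.1 σ (by linarith [hσI.1])).norm_sub_le hr (hwr σ hσI) (hwr' σ hσI)).trans ?_
    gcongr
    have h1 := h.norm_sub_le hM hs hr hwr hσI.1 hσ.2 hb
    have h2 := h'.norm_sub_le hM hs hr hwr' hσI.1 hσ.2 hb
    rw [norm_sub_rev] at h2
    have h3 : K * (b - σ) ≤ K * (b - a) := by gcongr; exact hσ.1.le
    have e2 : w σ - w' σ = (w b - w' b) + (w σ - w b) + (w' b - w' σ) := by abel
    rw [e2]
    refine norm_add₃_le.trans ?_
    linarith
  rw [abs_of_nonneg (by linarith : 0 ≤ b - a)] at hI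
  rw [e]
  refine (norm_add_le _ _).trans ((add_le_add_right hI _).trans (le_of_eq ?_))
  ring

omit [FiniteDimensional ℂ E] in
theorem mono_left (h : IsTrajectory M s t z w) {s' : ℝ} (hs : s ≤ s') : IsTrajectory M s' t z w :=
  ⟨h.continuousOn.mono (Icc_subset_Icc_left hs), h.mapsTo.mono_left (Icc_subset_Icc_left hs),
    fun τ hτ => h.eq τ ⟨hs.trans hτ.1, hτ.2⟩⟩

theorem mono_right (h : IsTrajectory M s t z w) (hM : IsHerglotzVectorField M) (hs : 0 ≤ s)
    {t' : ℝ} (ht : t' ≤ t) : IsTrajectory M s t' (w t') w :=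
  ⟨h.continuousOn.mono (Icc_subset_Icc_right ht), h.mapsTo.mono_left (Icc_subset_Icc_right ht),
    fun _ hτ => h.sub_eq_integral hM hs hτ.1 hτ.2 ht⟩

theorem trans (h : IsTrajectory M s t z w) {u : ℝ} {w' : ℝ → E} (hst : s ≤ t)
    (htu : t ≤ u) {x : E} (h' : IsTrajectory M t u x w') (hx : w' t = z)
    (hM : IsHerglotzVectorField M) (hs : 0 ≤ s) :
    IsTrajectory M s u x fun τ => if τ ≤ t then w τ else w' τ := by
  set W : ℝ → E := fun τ => if τ ≤ t then w τ else w' τ with hW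
  have hWl : EqOn W w (Icc s t) := fun τ hτ => if_pos hτ.2
  have hWr : EqOn W w' (Icc t u) := fun τ hτ => by
    rcases hτ.1.eq_or_lt with rfl | hlt
    · simp only [hW, le_refl, if_true]
      rw [hx, h.eq_right hst]
    · exact if_neg hlt.not_ge
  have hcover : Icc s t ∪ Icc t u = Icc s u := Icc_union_Icc_eq_Icc hst htu
  have hWc : ContinuousOn W (Icc s u) := by
    rw [← hcover]
    exact (h.continuousOn.congr hWl).union_of_isClosed (h'.continuousOn.congr hWr)
      isClosed_Icc isClosed_Icc
  have hWU : MapsTo W (Icc s u) (unitBall E) := by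
    intro τ hτ
    rw [← hcover] at hτ
    rcases hτ with hτ | hτ
    · rw [hWl hτ]; exact h.mapsTo hτ
    · rw [hWr hτ]; exact h'.mapsTo hτ
  have hint : ∀ a b, a ∈ Icc t u → b ∈ Icc t u →
      ∫ σ in a..b, M (W σ) σ = ∫ σ in a..b, M (w' σ) σ := fun a b ha hb =>
    intervalIntegral.integral_congr fun σ hσ => by
      rw [hWr (uIcc_subset_Icc ha hb hσ)]
  refine ⟨hWc, hWU, fun τ hτ => ?_⟩
  rcases le_total τ t with hτt | hτt
  · obtain ⟨r, hr, hwr⟩ := h.exists_norm_le hst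
    obtain ⟨r', hr', hwr'⟩ := h'.exists_norm_le htu
    have hτI : τ ∈ Icc s t := ⟨hτ.1, hτt⟩
    have e1 : ∫ σ in τ..t, M (W σ) σ = ∫ σ in τ..t, M (w σ) σ :=
      intervalIntegral.integral_congr fun σ hσ => by
        rw [hWl (uIcc_subset_Icc hτI ⟨hst, le_rfl⟩ hσ)]
    have hm : max r r' < 1 := max_lt hr hr'
    have hWm : ∀ τ ∈ Icc s u, ‖W τ‖ ≤ max r r' := by
      intro τ hτ
      rw [← hcover] at hτ
      rcases hτ with hτ | hτ
      · rw [hWl hτ]; exact (hwr τ hτ).trans (le_max_left _ _)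
      · rw [hWr hτ]; exact (hwr' τ hτ).trans (le_max_right _ _)
    rw [← intervalIntegral.integral_add_adjacent_intervals
      (hM.intervalIntegrable_comp hs hWc hm hWm hτ.1 hτt htu)
      (hM.intervalIntegrable_comp hs hWc hm hWm hst htu le_rfl), e1,
      hint t u ⟨le_rfl, htu⟩ ⟨htu, le_rfl⟩, hWl hτI, h.eq τ hτI, ← hx, h'.eq t ⟨le_rfl, htu⟩]
    abel
  · rw [hint τ u ⟨hτt, hτ.2⟩ ⟨htu, le_rfl⟩, hWr ⟨hτt, hτ.2⟩]
    exact h'.eq τ ⟨hτt, hτ.2⟩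

end IsTrajectory

end Trajectory

/-! ### The flow of a Herglotz vector field -/

section Flow

variable {E : Type*} [NormedAddCommGroup E] [NormedSpace ℂ E]

/-- Picard iterates for the backward equation of trajectories. -/
noncomputable def picardIterate (M : E → ℝ → E) (t : ℝ) : ℕ → ℝ → E → E
  | 0, _, z => z
  | k + 1, τ, z => z + ∫ σ in τ..t, M (picardIterate M t k σ z) σ

variable [FiniteDimensional ℂ E] {M : E → ℝ → E} {r s t : ℝ}

theorem picardIterate_spec (hM : IsHerglotzVectorField M) (hs : 0 ≤ s) (hst : s ≤ t)
    (hr : r < 1) (hδ : t - s ≤ (1 - (1 + r) / 2) ^ 3 / 1536) (k : ℕ) :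
    (∀ z, ‖z‖ ≤ r → ContinuousOn (fun τ => picardIterate M t k τ z) (Icc s t) ∧
      ∀ τ ∈ Icc s t, ‖picardIterate M t k τ z‖ ≤ (1 + r) / 2) ∧
    ∀ τ ∈ Icc s t, DifferentiableOn ℂ (picardIterate M t k τ) (ball 0 r) := by
  have := FiniteDimensional.complete ℂ E
  set r' := (1 + r) / 2 with hr'
  have hr'1 : r' < 1 := by linarith
  have h1r' : 0 < 1 - r' := by linarith
  set K := 48 / (1 - r') ^ 2 with hK
  have hK0 : 0 ≤ K := by positivity
  have hKδ : K * (t - s) ≤ r' - r := by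
    calc K * (t - s) ≤ K * ((1 - r') ^ 3 / 1536) := by gcongr
      _ = (1 - r') / 32 := by rw [hK]; field_simp; norm_num
      _ ≤ r' - r := by linarith
  induction k with
  | zero =>
    exact ⟨fun z hz => ⟨continuousOn_const, fun τ _ => hz.trans (by linarith)⟩,
      fun τ _ => differentiableOn_id⟩
  | succ k ih =>
    obtain ⟨ih1, ih2⟩ := ih
    have hbound : ∀ z, ‖z‖ ≤ r → ∀ σ ∈ Icc s t, ‖M (picardIterate M t k σ z) σ‖ ≤ K :=
      fun z hz σ hσ => (hM.1 σ (hs.trans hσ.1)).norm_le hr'1 ((ih1 z hz).2 σ hσ)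
    have hU : ∀ z, ‖z‖ ≤ r → MapsTo (fun τ => picardIterate M t k τ z) (Icc s t) (unitBall E) :=
      fun z hz σ hσ => mem_unitBall.2 (((ih1 z hz).2 σ hσ).trans_lt hr'1)
    have hmeas : ∀ z, ‖z‖ ≤ r → ∀ τ ∈ Icc s t, AEStronglyMeasurable
        (fun σ => M (picardIterate M t k σ z) σ) (volume.restrict (Ioc τ t)) := fun z hz τ hτ =>
      (hM.aestronglyMeasurable_comp hs hst (ih1 z hz).1 (hU z hz)).mono_set
        (Ioc_subset_Icc_self.trans (Icc_subset_Icc_left hτ.1))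
    refine ⟨fun z hz => ⟨?_, fun τ hτ => ?_⟩, fun τ hτ c hc => ?_⟩
    · have hint := hM.intervalIntegrable_comp hs (ih1 z hz).1 hr'1 (ih1 z hz).2 le_rfl hst le_rfl
      have h1 := intervalIntegral.continuousOn_primitive_interval_left
        (a := s) (b := t) (f := fun σ => M (picardIterate M t k σ z) σ) (μ := volume) (by
          rw [uIcc_of_le hst, integrableOn_Icc_iff_integrableOn_Ioc]
          exact (intervalIntegrable_iff_integrableOn_Ioc_of_le hst).1 hint)
      rw [uIcc_of_le hst] at h1
      exact continuousOn_const.add h1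
    · have h1 : ‖∫ σ in τ..t, M (picardIterate M t k σ z) σ‖ ≤ K * |t - τ| :=
        intervalIntegral.norm_integral_le_of_norm_le_const fun σ hσ => by
          rw [uIoc_of_le hτ.2] at hσ
          exact hbound z hz σ ⟨hτ.1.trans hσ.1.le, hσ.2⟩
      rw [abs_of_nonneg (by linarith [hτ.2])] at h1
      have h2 : K * (t - τ) ≤ K * (t - s) := by gcongr; exact hτ.1
      refine (norm_add_le _ _).trans ?_
      linarith
    · have hc' : ‖c‖ < r := mem_ball_zero_iff.1 hc
      have hsub : ball c (r - ‖c‖) ⊆ ball 0 r :=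
        ball_subset_ball' (by rw [dist_zero_right]; linarith)
      have hle : ∀ z ∈ ball c (r - ‖c‖), ‖z‖ ≤ r := fun z hz =>
        (mem_ball_zero_iff.1 (hsub hz)).le
      have h1 := (differentiableAt_integral_of_norm_le (μ := volume.restrict (Ioc τ t))
        (G := fun z σ => M (picardIterate M t k σ z) σ) (c := c) (R := r - ‖c‖) (C := K)
        (by linarith) ?_ ?_ fun z hz => hmeas z (hle z hz) τ hτ).1
      · refine (differentiableAt_id.add h1).congr_of_eventuallyEq
          (Eventually.of_forall fun z => ?_) |>.differentiableWithinAt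
        simp only [picardIterate, intervalIntegral.integral_of_le hτ.2]
        rfl
      · filter_upwards [ae_restrict_mem measurableSet_Ioc] with σ hσ
        have hσI : σ ∈ Icc s t := ⟨hτ.1.trans hσ.1.le, hσ.2⟩
        exact (hM.1 σ (hs.trans hσI.1)).1.comp ((ih2 σ hσI).mono hsub)
          fun z hz => hU z (hle z hz) hσI
      · filter_upwards [ae_restrict_mem measurableSet_Ioc] with σ hσ z hz
        exact hbound z (hle z hz) σ ⟨hτ.1.trans hσ.1.le, hσ.2⟩

/-- For short times, trajectories exist and depend holomorphically on the end point. The iterates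
stay in a fixed smaller ball and are holomorphic, so their limit is holomorphic. -/
theorem exists_isTrajectory_of_short (hM : IsHerglotzVectorField M) (hs : 0 ≤ s) (hst : s ≤ t)
    (hr : r < 1) (hδ : t - s ≤ (1 - (1 + r) / 2) ^ 3 / 1536) :
    ∃ W : ℝ → E → E, (∀ z, ‖z‖ ≤ r → IsTrajectory M s t z fun τ => W τ z) ∧
      ∀ τ ∈ Icc s t, DifferentiableOn ℂ (W τ) (ball 0 r) := by
  have := FiniteDimensional.complete ℂ E
  have hspec := picardIterate_spec hM hs hst hr hδ
  set r' := (1 + r) / 2 with hr'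
  have hr'1 : r' < 1 := by linarith
  have h1r' : 0 < 1 - r' := by linarith
  set L := 768 / (1 - r') ^ 3 with hL
  have hL0 : 0 ≤ L := by positivity
  have hLδ : L * (t - s) ≤ 1 / 2 := by
    calc L * (t - s) ≤ L * ((1 - r') ^ 3 / 1536) := by gcongr
      _ = 1 / 2 := by rw [hL]; field_simp; norm_num
  have hint : ∀ k z, ‖z‖ ≤ r → ∀ τ ∈ Icc s t, IntervalIntegrable
      (fun σ => M (picardIterate M t k σ z) σ) volume τ t := fun k z hz τ hτ =>
    hM.intervalIntegrable_comp hs ((hspec k).1 z hz).1 hr'1 ((hspec k).1 z hz).2 hτ.1 hτ.2 le_rfl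
  have hC : ∀ k z, ‖z‖ ≤ r → ∀ τ ∈ Icc s t,
      dist (picardIterate M t k τ z) (picardIterate M t (k + 1) τ z) ≤ 2 * (1 / 2) ^ k := by
    intro k z hz
    induction k with
    | zero =>
      intro τ hτ
      have h1 := ((hspec 0).1 z hz).2 τ hτ
      have h2 := ((hspec 1).1 z hz).2 τ hτ
      rw [pow_zero, mul_one]
      linarith [dist_le_norm_add_norm (picardIterate M t 0 τ z) (picardIterate M t (0 + 1) τ z)]
    | succ k ih =>
      intro τ hτ
      have e : picardIterate M t (k + 1) τ z - picardIterate M t (k + 1 + 1) τ z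
          = ∫ σ in τ..t, (M (picardIterate M t k σ z) σ - M (picardIterate M t (k + 1) σ z) σ) := by
        rw [intervalIntegral.integral_sub (hint k z hz τ hτ) (hint (k + 1) z hz τ hτ)]
        simp only [picardIterate]
        abel
      have h1 : ‖picardIterate M t (k + 1) τ z - picardIterate M t (k + 1 + 1) τ z‖
          ≤ L * (2 * (1 / 2) ^ k) * |t - τ| := by
        rw [e]
        refine intervalIntegral.norm_integral_le_of_norm_le_const fun σ hσ => ?_
        rw [uIoc_of_le hτ.2] at hσ
        have hσI : σ ∈ Icc s t := ⟨hτ.1.trans hσ.1.le, hσ.2⟩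
        refine ((hM.1 σ (hs.trans hσI.1)).norm_sub_le hr'1 (((hspec k).1 z hz).2 σ hσI)
          (((hspec (k + 1)).1 z hz).2 σ hσI)).trans ?_
        gcongr
        rw [← dist_eq_norm]
        exact ih σ hσI
      rw [dist_eq_norm]
      refine h1.trans ?_
      rw [abs_of_nonneg (by linarith [hτ.2])]
      calc L * (2 * (1 / 2) ^ k) * (t - τ) = (L * (t - τ)) * (2 * (1 / 2) ^ k) := by ring
        _ ≤ (1 / 2) * (2 * (1 / 2) ^ k) := by
            gcongr
            refine le_trans ?_ hLδ
            gcongr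
            exact hτ.1
        _ = _ := by ring
  have hlim : ∀ τ z, ∃ x, (‖z‖ ≤ r ∧ τ ∈ Icc s t) →
      Tendsto (fun k => picardIterate M t k τ z) atTop (𝓝 x) := by
    intro τ z
    by_cases h : ‖z‖ ≤ r ∧ τ ∈ Icc s t
    · obtain ⟨x, hx⟩ := cauchySeq_tendsto_of_complete
        (cauchySeq_of_le_geometric (1 / 2) 2 (by norm_num) fun k => hC k z h.1 τ h.2)
      exact ⟨x, fun _ => hx⟩
    · exact ⟨0, fun h' => absurd h' h⟩
  choose W hW' using hlim
  have hW : ∀ z, ‖z‖ ≤ r → ∀ τ ∈ Icc s t,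
      Tendsto (fun k => picardIterate M t k τ z) atTop (𝓝 (W τ z)) :=
    fun z hz τ hτ => hW' τ z ⟨hz, hτ⟩
  have hdist : ∀ k z, ‖z‖ ≤ r → ∀ τ ∈ Icc s t,
      dist (picardIterate M t k τ z) (W τ z) ≤ 4 * (1 / 2) ^ k := by
    intro k z hz τ hτ
    refine (dist_le_of_le_geometric_of_tendsto (1 / 2) 2 (by norm_num)
      (fun k => hC k z hz τ hτ) (hW z hz τ hτ) k).trans (le_of_eq ?_)
    ring
  have hpow : Tendsto (fun k : ℕ => 4 * (1 / 2 : ℝ) ^ k) atTop (𝓝 0) := by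
    simpa using (tendsto_pow_atTop_nhds_zero_of_lt_one (r := (1 / 2 : ℝ)) (by norm_num)
      (by norm_num)).const_mul 4
  have hWr : ∀ z, ‖z‖ ≤ r → ∀ τ ∈ Icc s t, ‖W τ z‖ ≤ r' := fun z hz τ hτ =>
    le_of_tendsto' (hW z hz τ hτ).norm fun k => ((hspec k).1 z hz).2 τ hτ
  refine ⟨W, fun z hz => ?_, fun τ hτ c hc => ?_⟩
  · have hWc : ContinuousOn (fun τ => W τ z) (Icc s t) := by
      refine TendstoUniformlyOn.continuousOn (F := fun k τ => picardIterate M t k τ z) (p := atTop)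
        ?_ (Eventually.of_forall fun k => ((hspec k).1 z hz).1).frequently
      rw [Metric.tendstoUniformlyOn_iff]
      intro ε hε
      filter_upwards [hpow.eventually_lt_const hε] with k hk τ hτ
      rw [dist_comm]
      exact (hdist k z hz τ hτ).trans_lt hk
    refine ⟨hWc, fun τ hτ => mem_unitBall.2 ((hWr z hz τ hτ).trans_lt hr'1), fun τ hτ => ?_⟩
    have hWint := hM.intervalIntegrable_comp hs hWc hr'1 (hWr z hz) hτ.1 hτ.2 le_rfl
    refine tendsto_nhds_unique ((tendsto_add_atTop_iff_nat 1).2 (hW z hz τ hτ)) ?_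
    simp only [picardIterate]
    refine tendsto_const_nhds.add ?_
    rw [tendsto_iff_norm_sub_tendsto_zero]
    refine squeeze_zero (fun _ => norm_nonneg _) (g := fun k => L * (4 * (1 / 2) ^ k) * |t - τ|)
      (fun k => ?_) (by simpa using (hpow.const_mul L).mul_const |t - τ|)
    rw [← intervalIntegral.integral_sub (hint k z hz τ hτ) hWint]
    refine intervalIntegral.norm_integral_le_of_norm_le_const fun σ hσ => ?_
    rw [uIoc_of_le hτ.2] at hσ
    have hσI : σ ∈ Icc s t := ⟨hτ.1.trans hσ.1.le, hσ.2⟩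
    refine ((hM.1 σ (hs.trans hσI.1)).norm_sub_le hr'1 (((hspec k).1 z hz).2 σ hσI)
      (hWr z hz σ hσI)).trans ?_
    gcongr
    rw [← dist_eq_norm]
    exact hdist k z hz σ hσI
  · have hc' : ‖c‖ < r := mem_ball_zero_iff.1 hc
    have hsub : ball c (r - ‖c‖) ⊆ ball 0 r :=
      ball_subset_ball' (by rw [dist_zero_right]; linarith)
    have hle : ∀ z ∈ ball c (r - ‖c‖), ‖z‖ ≤ r := fun z hz => (mem_ball_zero_iff.1 (hsub hz)).le
    exact (differentiableAt_of_tendsto_of_norm_le (R := r - ‖c‖) (C := r') (by linarith)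
      (Eventually.of_forall fun k => ⟨((hspec k).2 τ hτ).mono hsub,
        fun z hz => ((hspec k).1 z (hle z hz)).2 τ hτ⟩)
      fun z hz => hW z (hle z hz) τ hτ).1.differentiableWithinAt

theorem exists_isTrajectory (hM : IsHerglotzVectorField M) (hs : 0 ≤ s) (hst : s ≤ t) {z : E}
    (hz : z ∈ unitBall E) : ∃ w, IsTrajectory M s t z w := by
  set r := ‖z‖ with hr
  have hr1 : r < 1 := mem_unitBall.1 hz
  set δ := (1 - (1 + r) / 2) ^ 3 / 1536 with hδ
  have hδ0 : 0 < δ := by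
    have : 0 < 1 - (1 + r) / 2 := by linarith
    positivity
  have step : ∀ n : ℕ, ∀ s t, 0 ≤ s → s ≤ t → t - s ≤ n * δ → ∀ z : E, ‖z‖ ≤ r →
      ∃ w, IsTrajectory M s t z w := by
    intro n
    induction n with
    | zero =>
      intro s t hs hst htn z hz
      rw [Nat.cast_zero, zero_mul] at htn
      obtain ⟨W, hW, -⟩ := exists_isTrajectory_of_short hM hs hst hr1
        (htn.trans hδ0.le)
      exact ⟨_, hW z hz⟩
    | succ n ih =>
      intro s t hs hst htn z hz
      push_cast at htn
      set m := max s (t - δ) with hm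
      have hsm : s ≤ m := le_max_left _ _
      have hmt : m ≤ t := max_le hst (by linarith)
      obtain ⟨W, hW, -⟩ := exists_isTrajectory_of_short (s := m) (t := t) hM (hs.trans hsm) hmt
        hr1 (by linarith [le_max_right s (t - δ)])
      have hWm := (hW z hz).norm_le hM (hs.trans hsm) ⟨le_rfl, hmt⟩
      obtain ⟨w, hw⟩ := ih s m hs hsm (by
        rw [sub_le_iff_le_add]
        refine max_le ?_ (by linarith)
        have : 0 ≤ (n : ℝ) * δ := by positivity
        linarith) (W m z) (hWm.trans hz)
      exact ⟨_, hw.trans hsm hmt (hW z hz) rfl hM hs⟩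
  obtain ⟨n, hn⟩ := exists_nat_ge ((t - s) / δ)
  exact step n s t hs hst ((div_le_iff₀ hδ0).1 hn) z le_rfl

open Classical in
/-- The value at time `s` of the trajectory that ends at `z` at time `t`. (The value `z` where there
is no trajectory is irrelevant.) -/
noncomputable def flow {E : Type*} [NormedAddCommGroup E] [NormedSpace ℂ E] (M : E → ℝ → E)
    (s t : ℝ) (z : E) : E :=
  if h : ∃ w, IsTrajectory M s t z w then h.choose s else z

variable {z : E}

theorem IsTrajectory.flow_eq {w : ℝ → E} (h : IsTrajectory M s t z w)
    (hM : IsHerglotzVectorField M) (hs : 0 ≤ s) (hst : s ≤ t) : flow M s t z = w s := by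
  have hex : ∃ w, IsTrajectory M s t z w := ⟨w, h⟩
  rw [flow, dif_pos hex]
  exact hex.choose_spec.unique h hM hs ⟨le_rfl, hst⟩

theorem isTrajectory_flow (hM : IsHerglotzVectorField M) (hs : 0 ≤ s) (hst : s ≤ t)
    (hz : z ∈ unitBall E) : IsTrajectory M s t z fun τ => flow M τ t z := by
  obtain ⟨w, hw⟩ := exists_isTrajectory hM hs hst hz
  have heq : ∀ τ ∈ Icc s t, flow M τ t z = w τ := fun τ hτ =>
    (hw.mono_left hτ.1).flow_eq hM (hs.trans hτ.1) hτ.2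
  refine ⟨hw.continuousOn.congr heq, fun τ hτ => ?_, fun τ hτ => ?_⟩
  · rw [heq τ hτ]; exact hw.mapsTo hτ
  · rw [heq τ hτ, hw.eq τ hτ]
    congr 1
    refine intervalIntegral.integral_congr fun σ hσ => ?_
    rw [← heq σ (uIcc_subset_Icc hτ ⟨hst, le_rfl⟩ hσ)]

theorem flow_comp (hM : IsHerglotzVectorField M) (hs : 0 ≤ s) (hst : s ≤ t) {u : ℝ} (htu : t ≤ u)
    (hz : z ∈ unitBall E) : flow M s u z = flow M s t (flow M t u z) :=
  (((isTrajectory_flow hM hs (hst.trans htu) hz).mono_right hM hs htu).flow_eq hM hs hst).symm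

theorem norm_flow_le (hM : IsHerglotzVectorField M) (hs : 0 ≤ s) (hst : s ≤ t)
    (hz : z ∈ unitBall E) : ‖flow M s t z‖ ≤ ‖z‖ :=
  (isTrajectory_flow hM hs hst hz).norm_le hM hs ⟨le_rfl, hst⟩

theorem flow_mem (hM : IsHerglotzVectorField M) (hs : 0 ≤ s) (hst : s ≤ t)
    (hz : z ∈ unitBall E) : flow M s t z ∈ unitBall E :=
  mem_unitBall.2 ((norm_flow_le hM hs hst hz).trans_lt (mem_unitBall.1 hz))

theorem differentiableOn_flow (hM : IsHerglotzVectorField M) (hs : 0 ≤ s) (hst : s ≤ t) :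
    DifferentiableOn ℂ (flow M s t) (unitBall E) := by
  intro c hc
  set r := (1 + ‖c‖) / 2 with hr
  have hc1 := mem_unitBall.1 hc
  have hr1 : r < 1 := by linarith
  have hr0 : 0 ≤ r := by positivity
  have hsub : ball (0 : E) r ⊆ unitBall E := ball_subset_ball hr1.le
  set δ := (1 - (1 + r) / 2) ^ 3 / 1536 with hδ
  have hδ0 : 0 < δ := by
    have : 0 < 1 - (1 + r) / 2 := by linarith
    positivity
  have short : ∀ s t, 0 ≤ s → s ≤ t → t - s ≤ δ → DifferentiableOn ℂ (flow M s t) (ball 0 r) := by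
    intro s t hs hst hts
    obtain ⟨W, hW, hWd⟩ := exists_isTrajectory_of_short hM hs hst hr1 hts
    exact (hWd s ⟨le_rfl, hst⟩).congr fun z hz =>
      (hW z (mem_ball_zero_iff.1 hz).le).flow_eq hM hs hst
  have step : ∀ n : ℕ, ∀ s t, 0 ≤ s → s ≤ t → t - s ≤ n * δ →
      DifferentiableOn ℂ (flow M s t) (ball 0 r) := by
    intro n
    induction n with
    | zero =>
      intro s t hs hst htn
      rw [Nat.cast_zero, zero_mul] at htn
      exact short s t hs hst (htn.trans hδ0.le)
    | succ n ih =>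
      intro s t hs hst htn
      push_cast at htn
      set m := max s (t - δ) with hm
      have hsm : s ≤ m := le_max_left _ _
      have hmt : m ≤ t := max_le hst (by linarith)
      have h1 := short m t (hs.trans hsm) hmt (by linarith [le_max_right s (t - δ)])
      have h2 := ih s m hs hsm (by
        rw [sub_le_iff_le_add]
        refine max_le ?_ (by linarith)
        have : 0 ≤ (n : ℝ) * δ := by positivity
        linarith)
      refine (h2.comp h1 fun z hz => ?_).congr fun z hz => flow_comp hM hs hsm hmt (hsub hz)
      rw [mem_ball_zero_iff] at hz ⊢
      exact (norm_flow_le hM (hs.trans hsm) hmt (hsub (mem_ball_zero_iff.2 hz))).trans_lt hz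
  obtain ⟨n, hn⟩ := exists_nat_ge ((t - s) / δ)
  have h := step n s t hs hst ((div_le_iff₀ hδ0).1 hn)
  exact (h.differentiableAt (isOpen_ball.mem_nhds
    (mem_ball_zero_iff.2 (by linarith)))).differentiableWithinAt

theorem flow_zero (hM : IsHerglotzVectorField M) (hs : 0 ≤ s) (hst : s ≤ t) :
    flow M s t (0 : E) = 0 := by
  have := norm_flow_le hM hs hst (zero_mem_unitBall (E := E))
  rw [norm_zero] at this
  exact norm_le_zero_iff.1 this

/-- The derivative of the flow at the origin solves the linear equation `A(τ)' = A(τ)`. -/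
theorem fderiv_flow_zero (hM : IsHerglotzVectorField M) (hs : 0 ≤ s) (hst : s ≤ t) :
    fderiv ℂ (flow M s t) (0 : E) = (Real.exp (s - t) : ℂ) • ContinuousLinearMap.id ℂ E := by
  have := FiniteDimensional.complete ℂ E
  ext v
  set y : ℝ → E := fun τ => fderiv ℂ (flow M τ t) 0 v with hy
  have hybound : ∀ τ ∈ Icc s t, ‖y τ‖ ≤ 2 * ‖v‖ := fun τ hτ => by
    refine (ContinuousLinearMap.le_opNorm _ _).trans ?_
    gcongr
    have := norm_fderiv_le_of_forall_ball_norm_le one_pos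
      (differentiableOn_flow hM (hs.trans hτ.1) hτ.2) (C := 1) fun z hz =>
        (mem_unitBall.1 (flow_mem hM (hs.trans hτ.1) hτ.2 hz)).le
    simpa using this
  have hyeq : ∀ τ ∈ Icc s t, IntervalIntegrable y volume τ t ∧ y τ = v - ∫ σ in τ..t, y σ := by
    intro τ hτ
    have hτ0 := hs.trans hτ.1
    have hder : ∀ σ ∈ Ioc τ t, ∀ v : E, fderiv ℂ (fun z => M (flow M σ t z) σ) 0 v
        = -fderiv ℂ (flow M σ t) 0 v := by
      intro σ hσ v
      have hσ0 : 0 ≤ σ := by linarith [hσ.1]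
      have h1 : HasFDerivAt (fun z => M z σ) (-ContinuousLinearMap.id ℂ E) (flow M σ t 0) := by
        rw [flow_zero hM hσ0 hσ.2, ← (hM.1 σ hσ0).2.2.1]
        exact ((hM.1 σ hσ0).1.differentiableAt_unitBall zero_mem_unitBall).hasFDerivAt
      have h2 := h1.comp (0 : E) ((differentiableOn_flow hM hσ0
        hσ.2).differentiableAt_unitBall zero_mem_unitBall).hasFDerivAt
      have h3 : fderiv ℂ (fun z => M (flow M σ t z) σ) 0 = _ := h2.fderiv
      rw [h3]
      simp
    have h1 := differentiableAt_integral_of_norm_le (μ := volume.restrict (Ioc τ t))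
      (G := fun z σ => M (flow M σ t z) σ) (c := 0) (R := 1 / 2) (C := 48 / (1 - 1 / 2) ^ 2)
      (by norm_num) ?_ ?_ ?_
    · obtain ⟨hd, hI⟩ := h1
      obtain ⟨hi, hI⟩ := hI v
      have hcongr : (fun σ => fderiv ℂ (fun z => M (flow M σ t z) σ) 0 v)
          =ᵐ[volume.restrict (Ioc τ t)] fun σ => -y σ := by
        filter_upwards [ae_restrict_mem measurableSet_Ioc] with σ hσ
        exact hder σ hσ v
      refine ⟨?_, ?_⟩
      · rw [intervalIntegrable_iff_integrableOn_Ioc_of_le hτ.2]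
        have := (hi.congr hcongr).neg
        simpa [IntegrableOn] using this
      · have h2 := ((hasFDerivAt_id (0 : E)).add hd.hasFDerivAt).congr_of_eventuallyEq
          (f₁ := flow M τ t) (eventually_of_mem (unitBall_mem_nhds zero_mem_unitBall)
            fun z hz => by
              rw [(isTrajectory_flow hM hτ0 hτ.2 hz).eq τ ⟨le_rfl, hτ.2⟩,
                intervalIntegral.integral_of_le hτ.2]
              rfl)
        have h3 : y τ = v + fderiv ℂ (fun z => ∫ σ in Ioc τ t, M (flow M σ t z) σ) 0 v := by
          simp only [hy]
          rw [h2.fderiv]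
          rfl
        rw [h3, hI, integral_congr_ae hcongr, integral_neg, intervalIntegral.integral_of_le hτ.2,
          sub_eq_add_neg]
    · filter_upwards [ae_restrict_mem measurableSet_Ioc] with σ hσ
      have hσ0 : 0 ≤ σ := by linarith [hσ.1]
      have hsub : ball (0 : E) (1 / 2) ⊆ unitBall E := ball_subset_ball (by norm_num)
      exact (hM.1 σ hσ0).1.comp ((differentiableOn_flow hM hσ0 hσ.2).mono hsub)
        fun z hz => flow_mem hM hσ0 hσ.2 (hsub hz)
    · filter_upwards [ae_restrict_mem measurableSet_Ioc] with σ hσ z hz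
      have hσ0 : 0 ≤ σ := by linarith [hσ.1]
      have hsub : ball (0 : E) (1 / 2) ⊆ unitBall E := ball_subset_ball (by norm_num)
      exact (hM.1 σ hσ0).norm_le (by norm_num)
        ((norm_flow_le hM hσ0 hσ.2 (hsub hz)).trans (mem_ball_zero_iff.1 hz).le)
    · intro z hz
      have hsub : ball (0 : E) (1 / 2) ⊆ unitBall E := ball_subset_ball (by norm_num)
      have hT := isTrajectory_flow hM hτ0 hτ.2 (hsub hz)
      exact (hM.aestronglyMeasurable_comp hτ0 hτ.2 hT.continuousOn hT.mapsTo).mono_set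
        Ioc_subset_Icc_self
  have hsub : ∀ a b, s ≤ a → a ≤ b → b ≤ t →
      IntervalIntegrable y volume a b ∧ y a = y b - ∫ σ in a..b, y σ := by
    intro a b ha hab hb
    obtain ⟨hia, ha'⟩ := hyeq a ⟨ha, hab.trans hb⟩
    obtain ⟨hib, hb'⟩ := hyeq b ⟨ha.trans hab, hb⟩
    have hiab : IntervalIntegrable y volume a b := hia.trans hib.symm
    refine ⟨hiab, ?_⟩
    rw [ha', hb', ← intervalIntegral.integral_add_adjacent_intervals hiab hib]
    abel
  have hlip : ∀ a b, s ≤ a → a ≤ b → b ≤ t → ‖y b - y a‖ ≤ 2 * ‖v‖ * (b - a) := by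
    intro a b ha hab hb
    have h1 : ‖∫ σ in a..b, y σ‖ ≤ 2 * ‖v‖ * |b - a| :=
      intervalIntegral.norm_integral_le_of_norm_le_const fun σ hσ => by
        rw [uIoc_of_le hab] at hσ
        exact hybound σ ⟨by linarith [hσ.1], by linarith [hσ.2]⟩
    rw [abs_of_nonneg (by linarith)] at h1
    rwa [(hsub a b ha hab hb).2, sub_sub_cancel]
  have hquad : ∀ a b, s ≤ a → a ≤ b → b ≤ t →
      ‖y a - (1 - (b - a)) • y b‖ ≤ 2 * ‖v‖ * (b - a) ^ 2 := by
    intro a b ha hab hb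
    obtain ⟨hi, he⟩ := hsub a b ha hab hb
    have e : y a - (1 - (b - a)) • y b = ∫ σ in a..b, (y b - y σ) := by
      rw [intervalIntegral.integral_sub intervalIntegrable_const hi,
        intervalIntegral.integral_const, he]
      module
    rw [e]
    refine (intervalIntegral.norm_integral_le_of_norm_le_const (C := 2 * ‖v‖ * (b - a))
      fun σ hσ => ?_).trans (le_of_eq ?_)
    · rw [uIoc_of_le hab] at hσ
      refine (hlip σ b (by linarith [hσ.1]) hσ.2 hb).trans ?_
      gcongr
      exact hσ.1.le
    · rw [abs_of_nonneg (by linarith)]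
      ring
  have hfin := eq_zero_of_forall_le_add_sq (N := fun τ => ‖y τ - Real.exp (τ - t) • v‖) hst
    (L := 1) (C := 2 * ‖v‖ + ‖v‖) (by positivity) (fun _ => norm_nonneg _)
    (fun a b ha hab hb => ?_) ?_ zero_le_one
  · have h1 := sub_eq_zero.1 (norm_eq_zero.1 hfin)
    simp only [hy] at h1
    rw [h1, smul_apply, ContinuousLinearMap.id_apply, Complex.coe_smul]
  · have hexp : |Real.exp (a - b) - (1 - (b - a))| ≤ (b - a) ^ 2 := by
      rw [abs_of_nonneg (by linarith [Real.add_one_le_exp (a - b)])]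
      rcases le_total (b - a) 1 with h | h
      · have h1 := (le_abs_self _).trans (Real.abs_exp_sub_one_sub_id_le (x := a - b) (by
          rw [abs_le]; constructor <;> linarith))
        have e : (a - b) ^ 2 = (b - a) ^ 2 := by ring
        linarith
      · have h1 : Real.exp (a - b) ≤ 1 := Real.exp_le_one_iff.2 (by linarith)
        nlinarith
    have e : y a - Real.exp (a - t) • v = (1 - (b - a)) • (y b - Real.exp (b - t) • v)
        + (y a - (1 - (b - a)) • y b)
        - (Real.exp (a - b) - (1 - (b - a))) • (Real.exp (b - t) • v) := by
      have : Real.exp (a - t) = Real.exp (a - b) * Real.exp (b - t) := by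
        rw [← Real.exp_add]; ring_nf
      rw [this]
      module
    have h1 : ‖(1 - (b - a)) • (y b - Real.exp (b - t) • v)‖
        ≤ (1 + 1 * (b - a)) * ‖y b - Real.exp (b - t) • v‖ := by
      rw [norm_smul, Real.norm_eq_abs]
      gcongr
      rw [abs_le]
      constructor <;> linarith
    have h2 : ‖(Real.exp (a - b) - (1 - (b - a))) • (Real.exp (b - t) • v)‖
        ≤ (b - a) ^ 2 * ‖v‖ := by
      rw [norm_smul, norm_smul, Real.norm_eq_abs, Real.norm_eq_abs, abs_of_pos (Real.exp_pos _)]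
      gcongr
      exact mul_le_of_le_one_left (norm_nonneg _) (Real.exp_le_one_iff.2 (by linarith))
    rw [e]
    refine (norm_sub_le _ _).trans ((add_le_add (norm_add_le _ _) le_rfl).trans ?_)
    linarith [hquad a b ha hab hb]
  · have : y t = v := by simpa using (hyeq t ⟨hst, le_rfl⟩).2
    simp [this]

theorem isEvolutionFamily_flow (hM : IsHerglotzVectorField M) : IsEvolutionFamily (flow M) where
  isSchwarzMap _ _ hs hst := ⟨differentiableOn_flow hM hs hst, fun _ hz => flow_mem hM hs hst hz,
    flow_zero hM hs hst, fderiv_flow_zero hM hs hst⟩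
  comp _ _ _ hs hst htu _ hz := flow_comp hM hs hst htu hz

end Flow

/-! ### The Loewner equation for the flow -/

section FlowPDE

variable {E : Type*} [NormedAddCommGroup E] [NormedSpace ℂ E] [FiniteDimensional ℂ E]
  {M : E → ℝ → E} {z : E}

theorem isSubordinationChain_flow (hM : IsHerglotzVectorField M) :
    IsSubordinationChain fun t => flow M 0 t :=
  ⟨fun _ ht => differentiableOn_flow hM le_rfl ht, fun s t hs hst => ⟨flow M s t,
    differentiableOn_flow hM hs hst, fun _ hz => flow_mem hM hs hst hz, flow_zero hM hs hst,
    fun _ hz => flow_comp hM le_rfl hs hst hz⟩⟩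

theorem isNormalizedFamily_flow (hM : IsHerglotzVectorField M) :
    IsNormalizedFamily fun t => flow M 0 t :=
  ⟨fun _ hz => (isTrajectory_flow hM le_rfl le_rfl hz).eq_right le_rfl, fun t ht =>
    ⟨flow_zero hM le_rfl ht, by rw [fderiv_flow_zero hM le_rfl ht, zero_sub]⟩⟩

/-- By Lebesgue's differentiation theorem, for fixed `z` the flow has generator `M z t` at almost
every time `t`. -/
theorem ae_tendsto_flow (hM : IsHerglotzVectorField M) (hz : z ∈ unitBall E) :
    ∀ᵐ t ∂(volume.restrict (Ici (0 : ℝ))),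
      Tendsto (fun h : ℝ => h⁻¹ • (flow M t (t + h) z - z)) (𝓝[>] 0) (𝓝 (M z t)) := by
  have := FiniteDimensional.complete ℂ E
  have hz1 := mem_unitBall.1 hz
  set K := 48 / (1 - ‖z‖) ^ 2 with hK
  set g : ℝ → E := (Ici (0 : ℝ)).indicator fun t => M z t with hg
  have hgm : AEStronglyMeasurable g volume :=
    (aestronglyMeasurable_indicator_iff measurableSet_Ici).2 (hM.2 z hz)
  have hgK : ∀ t, ‖g t‖ ≤ K := by
    intro t
    by_cases ht : t ∈ Ici (0 : ℝ)
    · rw [hg, indicator_of_mem ht]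
      exact (hM.1 t ht).norm_le hz1 le_rfl
    · rw [hg, indicator_of_notMem ht, norm_zero]
      positivity
  have hgl : LocallyIntegrable g volume := by
    rw [locallyIntegrable_iff]
    intro k hk
    have : IsFiniteMeasure (volume.restrict k) := ⟨by
      rw [Measure.restrict_apply_univ]; exact hk.measure_lt_top⟩
    exact Integrable.of_bound hgm.restrict K (Eventually.of_forall hgK)
  filter_upwards [ae_restrict_of_ae (LocallyIntegrable.ae_hasDerivAt_integral hgl),
    ae_restrict_mem measurableSet_Ici] with t ht ht0
  have ht0' : 0 ≤ t := ht0
  have h1 := (ht t).tendsto_slope_zero_right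
  rw [hg, indicator_of_mem ht0, ← hg] at h1
  set C := 768 / (1 - ‖z‖) ^ 3 * (48 / (1 - ‖z‖) ^ 2) with hC
  have h2 : Tendsto (fun h : ℝ => h⁻¹ • (flow M t (t + h) z - z - ∫ σ in t..t + h, g σ))
      (𝓝[>] 0) (𝓝 0) := by
    have hlim : Tendsto (fun h : ℝ => C * h) (𝓝[>] 0) (𝓝 0) := by
      have : Continuous fun h : ℝ => C * h := by fun_prop
      simpa using (this.tendsto 0).mono_left nhdsWithin_le_nhds
    refine squeeze_zero_norm' ?_ hlim
    filter_upwards [self_mem_nhdsWithin] with h hh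
    have hh : 0 < h := hh
    have hth : t ≤ t + h := by linarith
    have hT := isTrajectory_flow hM ht0' hth hz
    have h3 := hT.norm_sub_sub_le hM ht0' hz1 (fun τ hτ => hT.norm_le hM ht0' hτ) le_rfl hth le_rfl
      (c := t + h) ⟨hth, le_rfl⟩
    rw [hT.eq_right hth, add_sub_cancel_left] at h3
    have e : ∫ σ in t..t + h, g σ = ∫ σ in t..t + h, M z σ := by
      refine intervalIntegral.integral_congr fun σ hσ => ?_
      rw [uIcc_of_le hth] at hσ
      exact indicator_of_mem (mem_Ici.2 (ht0'.trans hσ.1)) _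
    rw [e]
    refine norm_inv_smul_le (mul_nonneg ?_ hh.le) ?_
    · have : 0 < 1 - ‖z‖ := by linarith
      positivity
    · rw [abs_of_pos hh]
      linarith
  have h3 := h1.add h2
  rw [add_zero] at h3
  refine h3.congr fun h => ?_
  rw [intervalIntegral.integral_same, sub_zero, ← smul_add]
  congr 1
  abel

/-- The exceptional null set can be chosen independently of `z`, because the generator at time `t`
and `M · t` are both continuous. -/
theorem solvesLoewnerPDE_flow (hM : IsHerglotzVectorField M) :
    SolvesLoewnerPDE (fun t => flow M 0 t) M := by
  have := FiniteDimensional.proper ℂ E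
  have hf := isSubordinationChain_flow hM
  have hn := isNormalizedFamily_flow hM
  have hφ := isEvolutionFamily_flow hM
  refine ⟨hf.1, hn.1, ?_⟩
  obtain ⟨D, hDc, hDd⟩ := TopologicalSpace.exists_countable_dense E
  have hD : ∀ᵐ t ∂(volume.restrict (Ici (0 : ℝ))), ∀ z ∈ D, z ∈ unitBall E →
      Tendsto (fun h : ℝ => h⁻¹ • (flow M t (t + h) z - z)) (𝓝[>] 0) (𝓝 (M z t)) := by
    refine (ae_ball_iff hDc).2 fun z _ => ?_
    by_cases hz : z ∈ unitBall E
    · filter_upwards [ae_tendsto_flow hM hz] with t ht _ using ht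
    · exact Eventually.of_forall fun t h => absurd h hz
  filter_upwards [hφ.ae_exists_generator hf hn fun s t hs hst z hz => flow_comp hM le_rfl hs hst hz,
    hD, ae_restrict_mem measurableSet_Ici] with t ht htD ht0 z hz
  choose! m hm hmd using ht
  have hmH := hφ.isHerglotzFunction_of_tendsto ht0 hm
  have heq : EqOn m (fun z => M z t) (unitBall E) := by
    refine EqOn.of_subset_closure (s := unitBall E ∩ D) (fun x hx => ?_) hmH.1.continuousOn
      (hM.1 t ht0).1.continuousOn inter_subset_left
      (hDd.open_subset_closure_inter isOpen_unitBall)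
    exact tendsto_nhds_unique (hm x hx.1) (htD x hx.2 hx.1)
  have := hmd z hz
  rwa [heq hz] at this

theorem isAbsolutelyContinuousFamily_flow (hM : IsHerglotzVectorField M) :
    IsAbsolutelyContinuousFamily fun t => flow M 0 t := by
  intro z hz T hT
  have h1 : 0 < 1 - ‖z‖ := by linarith [mem_unitBall.1 hz]
  refine LipschitzOnWith.absolutelyContinuousOnInterval (K := Real.toNNReal (96 / (1 - ‖z‖) ^ 3))
    (LipschitzOnWith.of_dist_le_mul fun t ht s hs => ?_)
  rw [uIcc_of_le hT] at ht hs
  rw [Real.coe_toNNReal _ (by positivity), dist_eq_norm, Real.dist_eq]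
  exact (isEvolutionFamily_flow hM).norm_sub_le_of_eq (f := fun t => flow M 0 t)
    (fun _ _ _ _ => rfl) hs.1 ht.1 (mem_unitBall.1 hz) le_rfl

end FlowPDE

/-! ### Uniqueness of absolutely continuous solutions -/

section Uniqueness

variable {E : Type*} [NormedAddCommGroup E] [NormedSpace ℂ E]

theorem AbsolutelyContinuousOnInterval.norm_sub_le_integral {V : Type*} [NormedAddCommGroup V]
    [NormedSpace ℝ V] {g : ℝ → V} {φ : ℝ → ℝ} {a b : ℝ}
    (hg : AbsolutelyContinuousOnInterval g a b) (hab : a ≤ b) (hφ : Continuous φ)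
    (h : ∀ᵐ x, x ∈ Icc a b → ∃ g', HasDerivAt g g' x ∧ ‖g'‖ ≤ φ x) :
    ‖g b - g a‖ ≤ ∫ x in a..b, φ x := by
  rcases eq_or_ne (g b - g a) 0 with h0 | h0
  · rw [h0, norm_zero]
    refine intervalIntegral.integral_nonneg_of_ae_restrict hab ?_
    filter_upwards [ae_restrict_of_ae h, ae_restrict_mem measurableSet_Icc] with x hx hxI
    obtain ⟨g', -, hg'⟩ := hx hxI
    exact (norm_nonneg _).trans hg'
  obtain ⟨l, hl1, hl⟩ := exists_dual_vector ℝ (g b - g a) (norm_ne_zero_iff.2 h0)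
  have hle : ∀ x, ‖l x‖ ≤ ‖x‖ := fun x => by simpa [hl1] using l.le_opNorm x
  have hac : AbsolutelyContinuousOnInterval (fun x => l (g x)) a b := by
    refine squeeze_zero (fun _ => Finset.sum_nonneg fun _ _ => dist_nonneg)
      (fun I => Finset.sum_le_sum fun i _ => ?_) hg
    rw [dist_eq_norm, dist_eq_norm, ← map_sub]
    exact hle _
  have hFTC := hac.integral_deriv_eq_sub
  have e : ‖g b - g a‖ = l (g b) - l (g a) := by rw [← map_sub, hl]; rfl
  rw [e, ← hFTC]
  refine intervalIntegral.integral_mono_ae_restrict hab hac.intervalIntegrable_deriv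
    (hφ.intervalIntegrable a b) ?_
  filter_upwards [ae_restrict_of_ae h, ae_restrict_mem measurableSet_Icc] with x hx hxI
  obtain ⟨g', hd, hg'⟩ := hx hxI
  have h1 : HasDerivAt (fun x => l (g x)) (l g') x := l.hasFDerivAt.comp_hasDerivAt x hd
  rw [h1.deriv]
  exact (le_abs_self _).trans ((hle g').trans hg')

variable [FiniteDimensional ℂ E] {M : E → ℝ → E} {k : ℝ → E → E}

/-- The Baire category theorem provides a ball on which a family of holomorphic maps that is merely
continuous in time at each point is bounded uniformly in time. -/
theorem exists_ball_forall_norm_le {T : ℝ}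
    (hd : ∀ t, 0 ≤ t → DifferentiableOn ℂ (k t) (unitBall E))
    (hc : ∀ z ∈ unitBall E, ContinuousOn (fun t => k t z) (Icc 0 T)) :
    ∃ c ∈ unitBall E, ∃ ρ > 0, ball c ρ ⊆ closedBall 0 ((1 + ‖c‖) / 2) ∧ ∃ N : ℝ, 0 ≤ N ∧
      ∀ t ∈ Icc 0 T, ∀ z ∈ ball c ρ, ‖k t z‖ ≤ N := by
  have := FiniteDimensional.proper ℂ E
  have : LocallyCompactSpace (unitBall E) := isOpen_unitBall.locallyCompactSpace
  have : Nonempty (unitBall E) := ⟨⟨0, zero_mem_unitBall⟩⟩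
  let F : ℕ → Set (unitBall E) := fun n => {z | ∀ t ∈ Icc 0 T, ‖k t z‖ ≤ n}
  have hFc : ∀ n, IsClosed (F n) := by
    intro n
    have e : F n = ⋂ t ∈ Icc 0 T, {z : unitBall E | ‖k t z‖ ≤ n} := by ext z; simp [F]
    rw [e]
    refine isClosed_biInter fun t ht => isClosed_le ?_ continuous_const
    exact (continuousOn_iff_continuous_domRestrict.1 (hd t ht.1).continuousOn).norm
  have hFu : (⋃ n, F n) = univ := by
    refine eq_univ_of_forall fun z => ?_
    obtain ⟨C, hC⟩ := isCompact_Icc.exists_bound_of_continuousOn (hc z z.2)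
    obtain ⟨n, hn⟩ := exists_nat_ge C
    exact mem_iUnion.2 ⟨n, fun t ht => (hC t ht).trans hn⟩
  obtain ⟨n, c, hcn⟩ := nonempty_interior_of_iUnion_of_closed hFc hFu
  have hopen : IsOpen (Subtype.val '' interior (F n)) :=
    isOpen_unitBall.isOpenMap_subtype_val _ isOpen_interior
  obtain ⟨ε, hε, hεn⟩ := Metric.isOpen_iff.1 hopen c ⟨c, hcn, rfl⟩
  have hc1 := mem_unitBall.1 c.2
  refine ⟨c, c.2, min ε ((1 - ‖(c : E)‖) / 2), lt_min hε (by linarith), fun z hz => ?_, n,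
    n.cast_nonneg, fun t ht z hz => ?_⟩
  · have h1 : dist z c < (1 - ‖(c : E)‖) / 2 := (mem_ball.1 hz).trans_le (min_le_right _ _)
    rw [dist_eq_norm] at h1
    rw [mem_closedBall_zero_iff]
    linarith [norm_le_norm_add_norm_sub' z c]
  · obtain ⟨w, hw, rfl⟩ := hεn (ball_subset_ball (min_le_left _ _) hz)
    exact interior_subset hw t ht

/-- A Cauchy-Kovalevskaya type iteration: on shrinking concentric balls, the equation and Cauchy's
estimate improve the bound `N` to `N (2 K (s - a) / η)^j / j!`. -/
theorem norm_le_of_solves_linear (hM : IsHerglotzVectorField M)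
    (hd : ∀ t, 0 ≤ t → DifferentiableOn ℂ (k t) (unitBall E))
    (hpde : ∀ᵐ t ∂(volume.restrict (Ici (0 : ℝ))), ∀ z ∈ unitBall E,
      HasDerivAt (fun s => k s z) (fderiv ℂ (k t) z (M z t)) t)
    (hac : IsAbsolutelyContinuousFamily k) {a T : ℝ} (ha : 0 ≤ a)
    (hka : ∀ z ∈ unitBall E, k a z = 0) {c : E} {ρ r N η : ℝ} (hr : r < 1)
    (hρ : ball c ρ ⊆ closedBall 0 r) (hN : ∀ t ∈ Icc 0 T, ∀ z ∈ ball c ρ, ‖k t z‖ ≤ N)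
    (hη : 0 < η) (j : ℕ) :
    ∀ s ∈ Icc a T, ∀ z ∈ ball c (ρ - j * η),
      ‖k s z‖ ≤ N * (2 * (48 / (1 - r) ^ 2) / η) ^ j * (s - a) ^ j / j.factorial := by
  set K := 48 / (1 - r) ^ 2 with hK
  have hK0 : 0 ≤ K := by positivity
  induction j with
  | zero =>
    intro s hs z hz
    simpa using hN s ⟨ha.trans hs.1, hs.2⟩ z (by simpa using hz)
  | succ j ih =>
    intro s hs z hz
    have hsub : ball z η ⊆ ball c (ρ - j * η) := by
      refine ball_subset_ball' ?_
      have := (mem_ball.1 hz).le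
      push_cast at this
      linarith
    have hsubρ : ball c (ρ - j * η) ⊆ ball c ρ := ball_subset_ball (by
      have : 0 ≤ (j : ℝ) * η := by positivity
      linarith)
    have hcU : closedBall (0 : E) r ⊆ unitBall E := closedBall_subset_ball hr
    have hzr : z ∈ closedBall (0 : E) r := hρ (hsubρ (hsub (mem_ball_self hη)))
    have hzU : z ∈ unitBall E := hcU hzr
    have h1 := (hac z hzU s (ha.trans hs.1)).mono (c := a) (d := s) (by
      rw [uIcc_of_le hs.1, uIcc_of_le (ha.trans hs.1)]; exact Icc_subset_Icc_left ha)
    have h2 := h1.norm_sub_le_integral hs.1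
      (φ := fun x => N * (2 * K / η) ^ (j + 1) / j.factorial * (x - a) ^ j) (by fun_prop) (by
        filter_upwards [(ae_restrict_iff' measurableSet_Ici).1 hpde] with x hx hxI
        have hx0 : 0 ≤ x := ha.trans hxI.1
        refine ⟨_, hx hx0 z hzU, ?_⟩
        have hxT : x ∈ Icc a T := ⟨hxI.1, hxI.2.trans hs.2⟩
        have h3 := norm_fderiv_le_of_forall_ball_norm_le hη
          ((hd x hx0).mono (hsub.trans (hsubρ.trans (hρ.trans hcU))))
          fun w hw => ih x hxT w (hsub hw)
        have h4 := (hM.1 x hx0).norm_le hr (mem_closedBall_zero_iff.1 hzr)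
        refine ((fderiv ℂ (k x) z).le_of_opNorm_le_of_le h3 h4).trans (le_of_eq ?_)
        ring)
    rw [hka z hzU, sub_zero] at h2
    refine h2.trans (le_of_eq ?_)
    rw [intervalIntegral.integral_const_mul,
      intervalIntegral.integral_comp_sub_right (fun x => x ^ j) a, integral_pow, sub_self,
      Nat.factorial_succ]
    push_cast
    field_simp
    simp

theorem eq_zero_of_solves_linear (hM : IsHerglotzVectorField M)
    (hd : ∀ t, 0 ≤ t → DifferentiableOn ℂ (k t) (unitBall E)) (hk0 : ∀ z ∈ unitBall E, k 0 z = 0)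
    (hpde : ∀ᵐ t ∂(volume.restrict (Ici (0 : ℝ))), ∀ z ∈ unitBall E,
      HasDerivAt (fun s => k s z) (fderiv ℂ (k t) z (M z t)) t)
    (hac : IsAbsolutelyContinuousFamily k) {T : ℝ} (hT : 0 ≤ T) :
    ∀ z ∈ unitBall E, k T z = 0 := by
  have := FiniteDimensional.complete ℂ E
  obtain ⟨c, hc, ρ, hρ0, hρ, N, hN0, hN⟩ := exists_ball_forall_norm_le (T := T) hd fun z hz => by
    have := (hac z hz T hT).continuousOn
    rwa [uIcc_of_le hT] at this
  set r := (1 + ‖c‖) / 2 with hr_def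
  have hr : r < 1 := by linarith [mem_unitBall.1 hc]
  set K := 48 / (1 - r) ^ 2 with hK
  have hK0 : 0 < K := by
    have : 0 < 1 - r := by linarith
    positivity
  set ε := ρ / (8 * Real.exp 1 * K) with hε
  have hε0 : 0 < ε := by positivity
  have hlocal : ∀ a s, 0 ≤ a → a ≤ s → s ≤ T → s - a ≤ ε → (∀ z ∈ unitBall E, k a z = 0) →
      ∀ z ∈ unitBall E, k s z = 0 := by
    intro a s ha has hsT hsε hka z hz
    refine eqOn_zero_unitBall_of_eqOn_zero_ball (hd s (ha.trans has)) hc (half_pos hρ0)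
      (fun w hw => ?_) hz
    have hbound : ∀ J : ℕ, ‖k s w‖ ≤ N * (1 / 2) ^ (J + 1) := by
      intro J
      set η := ρ / (2 * (J + 1 : ℕ)) with hη
      have hJ : (0 : ℝ) < (J + 1 : ℕ) := by positivity
      have h1 := norm_le_of_solves_linear hM hd hpde hac ha hka hr hρ hN (η := η) (by positivity)
        (J + 1) s ⟨has, hsT⟩ w (by
          have e : ρ - (J + 1 : ℕ) * η = ρ / 2 := by rw [hη]; field_simp; ring
          rwa [e])
      refine h1.trans ?_
      have hs0 : 0 ≤ s - a := by linarith
      have e : N * (2 * K / η) ^ (J + 1) * (s - a) ^ (J + 1) / (J + 1).factorial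
          = N * ((4 * K / ρ * (s - a)) ^ (J + 1)
            * (((J + 1 : ℕ) : ℝ) ^ (J + 1) / (J + 1).factorial)) := by
        rw [hη]
        have : 2 * K / (ρ / (2 * ((J + 1 : ℕ) : ℝ))) = 4 * K / ρ * ((J + 1 : ℕ) : ℝ) := by
          field_simp; ring
        rw [this, mul_pow (4 * K / ρ) ((J + 1 : ℕ) : ℝ), mul_pow (4 * K / ρ) (s - a)]
        ring
      rw [e]
      gcongr
      -- `J ^ J / J! ≤ exp J`
      have h2 := Real.pow_div_factorial_le_exp ((J + 1 : ℕ) : ℝ) hJ.le (J + 1)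
      have h3 : Real.exp ((J + 1 : ℕ) : ℝ) = Real.exp 1 ^ (J + 1) := by
        rw [← Real.exp_nat_mul, mul_one]
      calc (4 * K / ρ * (s - a)) ^ (J + 1) * (((J + 1 : ℕ) : ℝ) ^ (J + 1) / (J + 1).factorial)
          ≤ (4 * K / ρ * ε) ^ (J + 1) * Real.exp 1 ^ (J + 1) := by
            rw [← h3]
            gcongr
        _ = (4 * K / ρ * ε * Real.exp 1) ^ (J + 1) := by rw [← mul_pow]
        _ = (1 / 2) ^ (J + 1) := by
            congr 1
            rw [hε]
            field_simp
            norm_num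
    have hlim : Tendsto (fun J : ℕ => N * (1 / 2 : ℝ) ^ (J + 1)) atTop (𝓝 0) := by
      have := (tendsto_pow_atTop_nhds_zero_of_lt_one (r := (1 / 2 : ℝ)) (by norm_num)
        (by norm_num)).const_mul N
      rw [mul_zero] at this
      exact (tendsto_add_atTop_iff_nat (f := fun J => N * (1 / 2 : ℝ) ^ J) 1).2 this
    exact norm_le_zero_iff.1 (ge_of_tendsto' hlim hbound)
  have hstep : ∀ n : ℕ, ∀ s, 0 ≤ s → s ≤ T → s ≤ n * ε → ∀ z ∈ unitBall E, k s z = 0 := by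
    intro n
    induction n with
    | zero =>
      intro s hs _ hsn
      obtain rfl : s = 0 := le_antisymm (by simpa using hsn) hs
      exact hk0
    | succ n ih =>
      intro s hs hsT hsn
      push_cast at hsn
      have hn : 0 ≤ (n : ℝ) * ε := by positivity
      exact hlocal (max 0 (s - ε)) s (le_max_left _ _) (max_le hs (by linarith)) hsT
        (by linarith [le_max_right 0 (s - ε)])
        (ih _ (le_max_left _ _) (max_le hT (by linarith)) (max_le hn (by linarith)))
  obtain ⟨n, hn⟩ := exists_nat_ge (T / ε)
  exact hstep n T hT le_rfl ((div_le_iff₀ hε0).1 hn)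

theorem SolvesLoewnerPDE.eq_of_isAbsolutelyContinuousFamily (hM : IsHerglotzVectorField M)
    {f g : ℝ → E → E} (hf : SolvesLoewnerPDE f M) (hfac : IsAbsolutelyContinuousFamily f)
    (hg : SolvesLoewnerPDE g M) (hgac : IsAbsolutelyContinuousFamily g) {t : ℝ} (ht : 0 ≤ t)
    {z : E} (hz : z ∈ unitBall E) : g t z = f t z := by
  refine sub_eq_zero.1 (eq_zero_of_solves_linear (k := fun t z => g t z - f t z) hM
    (fun t ht => (hg.1 t ht).sub (hf.1 t ht)) (fun z hz => ?_) ?_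
    (fun z hz T hT => (hgac z hz T hT).sub (hfac z hz T hT)) ht z hz)
  · rw [hg.2.1 z hz, hf.2.1 z hz, sub_self]
  · filter_upwards [hf.2.2, hg.2.2, ae_restrict_mem measurableSet_Ici] with t htf htg ht0 z hz
    have e : fderiv ℂ (fun z => g t z - f t z) z = fderiv ℂ (g t) z - fderiv ℂ (f t) z :=
      fderiv_sub ((hg.1 t ht0).differentiableAt_unitBall hz)
        ((hf.1 t ht0).differentiableAt_unitBall hz)
    rw [e, sub_apply]
    exact (htg z hz).sub (htf z hz)

end Uniqueness

theorem theorem2p5 {E : Type*} [NormedAddCommGroup E] [NormedSpace ℂ E]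
    [FiniteDimensional ℂ E] :
    (∀ f : ℝ → E → E, IsSubordinationChain f → IsNormalizedFamily f →
      IsLoewnerChain f ∧
        ∃ M : E → ℝ → E, IsHerglotzVectorField M ∧ SolvesLoewnerPDE f M) ∧
    (∀ M : E → ℝ → E, IsHerglotzVectorField M →
      ∃ f : ℝ → E → E,
        (SolvesLoewnerPDE f M ∧ IsAbsolutelyContinuousFamily f) ∧
        (∀ g : ℝ → E → E, SolvesLoewnerPDE g M → IsAbsolutelyContinuousFamily g →
          ∀ t, 0 ≤ t → ∀ z ∈ unitBall E, g t z = f t z) ∧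
        IsLoewnerChain f) := by
  refine ⟨fun f hf hn => ⟨hf.isLoewnerChain hn, hf.exists_isHerglotzVectorField hn⟩, fun M hM => ?_⟩
  have hpde := solvesLoewnerPDE_flow hM
  have hac := isAbsolutelyContinuousFamily_flow hM
  exact ⟨fun t => flow M 0 t, ⟨hpde, hac⟩,
    fun g hg hgac t ht z hz => hpde.eq_of_isAbsolutelyContinuousFamily hM hac hg hgac ht hz,
    (isSubordinationChain_flow hM).isLoewnerChain (isNormalizedFamily_flow hM)⟩
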